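/- Let $M$ be a closed (compact, without boundary) smooth 3-manifold with a contact structure $\xi$ and a smooth endomorphism $J:\xi\to\xi$, $J^2=-1$. For a contact form $\theta$ with $\ker\theta=\xi$, call $(J,\theta)$ a positive pseudohermitian structure if $d\theta(v,Jv)>0$ for all nonzero $v\in\xi$. Near every point there is then a complex 1-form $\theta^1$ with $\theta^1\circ J=i\,\theta^1$ on $\xi$ and $d\theta=i\,\theta^1\wedge\theta^{\bar 1}$ (where $\theta^{\bar1}=\overline{\theta^1}$); the connection form $\omega_1{}^1$ is determined by $d\theta^1=\theta^1\wedge\omega_1{}^1+A^1{}_{\bar 1}\,\theta\wedge\theta^{\bar 1}$ and $\omega_1{}^1+\overline{\omega_1{}^1}=0$, and the Tanaka-Webster curvature $W$ of $(J,\theta)$ is the real function with $d\omega_1{}^1\equiv W\,\theta^1\wedge\theta^{\bar 1}$ modulo $\theta$ (it does not depend on the choice of $\theta^1$). Let $I\subseteq[0,\infty)$ be an interval containing $0$, and let $\theta_{(t)}$, $t\in I$, be a smooth solution of the (unnormalized) Yamabe flow $$\partial_t\theta_{(t)}=-2W_{(t)}\theta_{(t)},$$ that is, each $(J,\theta_{(t)})$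 is a positive pseudohermitian structure with $\ker\theta_{(t)}=\xi$ and Tanaka-Webster curvature $W_{(t)}$, and $\theta_{(t)}=e^{2\lambda_{(t)}}\hat\theta$ for a fixed contact form $\hat\theta$ such that $(J,\hat\theta)$ is a positive pseudohermitian structure with $\ker\hat\theta=\xi$ and a function $\lambda$ that is smooth on $I\times M$. If $c>0$ is a constant with $W_{(0)}\ge c$ on $M$, then $W_{(t)}\ge c$ on $M$ for all $t\in I$. -/

import Mathlib

open Set Topology
open scoped Manifold ContDiff

noncomputable section PseudohermitianGeometry

/-- Euclidean 3-space, the model space of 3-manifolds. -/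
abbrev E3 : Type := EuclideanSpace ℝ (Fin 3)

variable (M : Type*) [TopologicalSpace M] [ChartedSpace E3 M]

/-- Vector fields on `M` (no regularity imposed). -/
abbrev VecField : Type _ := ∀ x : M, TangentSpace (𝓡 3) x

/-- Real 1-forms on `M` (no regularity imposed). -/
abbrev RealOneForm : Type _ := ∀ x : M, TangentSpace (𝓡 3) x →L[ℝ] ℝ

/-- Complex-valued 1-forms on `M` (no regularity imposed). A complex 1-form on `TM ⊗ ℂ` is given by
its restriction to `TM`. -/
abbrev ComplexOneForm : Type _ := ∀ x : M, TangentSpace (𝓡 3) x →L[ℝ] ℂ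

variable {M}

/-- Smoothness of a vector field on a set, as a section of the tangent bundle. -/
def SmoothVecFieldOn [IsManifold (𝓡 3) ∞ M] (X : VecField M) (U : Set M) : Prop :=
  ContMDiffOn (𝓡 3) ((𝓡 3).prod 𝓘(ℝ, E3)) ∞
    (fun x => Bundle.TotalSpace.mk' E3 (E := fun x : M => TangentSpace (𝓡 3) x) x (X x)) U

/-- Smoothness on a set of a 1-form with values in `F`, as a section of the bundle
`Hom(TM, F)`. -/
def SmoothOneFormOn [IsManifold (𝓡 3) ∞ M] {F : Type*} [NormedAddCommGroup F] [NormedSpace ℝ F]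
    (α : ∀ x : M, TangentSpace (𝓡 3) x →L[ℝ] F) (U : Set M) : Prop :=
  ContMDiffOn (𝓡 3) ((𝓡 3).prod 𝓘(ℝ, E3 →L[ℝ] F)) ∞
    (fun x => Bundle.TotalSpace.mk' (E3 →L[ℝ] F)
      (E := fun x : M => TangentSpace (𝓡 3) x →L[ℝ] Bundle.Trivial M F x) x (α x)) U

/-- The expression of a 1-form in the chart around `x₀`, i.e. its pullback under the inverse of that
chart. -/
def formInChart {F : Type*} [NormedAddCommGroup F] [NormedSpace ℝ F]
    (α : ∀ x : M, TangentSpace (𝓡 3) x →L[ℝ] F) (x₀ : M) (y : E3) : E3 →L[ℝ] F :=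
  (α ((extChartAt (𝓡 3) x₀).symm y)).comp
    (mfderiv 𝓘(ℝ, E3) (𝓡 3) (extChartAt (𝓡 3) x₀).symm y)

/-- The exterior derivative `dα` of a 1-form at `x`, evaluated on two tangent vectors: in local
coordinates, `dα(u, v) = ∑ (∂ᵢαⱼ - ∂ⱼαᵢ) uⁱ vʲ`. -/
def extD {F : Type*} [NormedAddCommGroup F] [NormedSpace ℝ F]
    (α : ∀ x : M, TangentSpace (𝓡 3) x →L[ℝ] F) (x : M) (u v : TangentSpace (𝓡 3) x) : F :=
  let u' : E3 := mfderiv (𝓡 3) 𝓘(ℝ, E3) (extChartAt (𝓡 3) x) x u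
  let v' : E3 := mfderiv (𝓡 3) 𝓘(ℝ, E3) (extChartAt (𝓡 3) x) x v
  let D := fderiv ℝ (formInChart α x) (extChartAt (𝓡 3) x x)
  D u' v' - D v' u'

/-- `α` is a contact form at each point of `U`: it is smooth and `α ∧ dα ≠ 0`, where
`(α ∧ dα)(u, v, w) = α(u) dα(v, w) + α(v) dα(w, u) + α(w) dα(u, v)`. -/
def IsContactFormOn [IsManifold (𝓡 3) ∞ M] (α : RealOneForm M) (U : Set M) : Prop :=
  SmoothOneFormOn α U ∧ ∀ x ∈ U, ∃ u v w : TangentSpace (𝓡 3) x,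
    α x u * extD α x v w + α x v * extD α x w u + α x w * extD α x u v ≠ 0

variable (M) in
/-- A contact structure `ξ` on `M` (a plane field that is locally the kernel of a contact form),
together with a CR structure compatible with it: a smooth endomorphism `J : ξ → ξ` with
`J² = -1`. -/
structure CRStructure [IsManifold (𝓡 3) ∞ M] where
  /-- the plane field -/
  ξ : ∀ x : M, Submodule ℝ (TangentSpace (𝓡 3) x)
  contact : ∀ x : M, ∃ U : Set M, IsOpen U ∧ x ∈ U ∧ ∃ α : RealOneForm M,
    IsContactFormOn α U ∧ ∀ y ∈ U, ∀ v, v ∈ ξ y ↔ α y v = 0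
  /-- the complex structure on the plane field -/
  J : ∀ x : M, ξ x →ₗ[ℝ] ξ x
  smooth_J : ∀ U : Set M, IsOpen U → ∀ X : ∀ x : M, ξ x,
    SmoothVecFieldOn (fun x => (X x : TangentSpace (𝓡 3) x)) U →
      SmoothVecFieldOn (fun x => (J x (X x) : TangentSpace (𝓡 3) x)) U
  J_J : ∀ (x : M) (v : ξ x), J x (J x v) = -v

/-- `(J, θ)` is a positive pseudohermitian structure: `θ` is a global contact form with kernel `ξ`,
and `dθ(v, Jv) > 0` for every nonzero `v` in `ξ` (equivalently `h_{1 1̄} > 0`, where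
`dθ = i h_{1 1̄} θ¹ ∧ θ¹̄`). -/
structure IsPosPseudohermitian [IsManifold (𝓡 3) ∞ M] (S : CRStructure M) (θ : RealOneForm M) :
    Prop where
  contact : IsContactFormOn θ univ
  ker : ∀ (x : M) (v : TangentSpace (𝓡 3) x), v ∈ S.ξ x ↔ θ x v = 0
  pos : ∀ (x : M) (v : S.ξ x), v ≠ 0 → 0 < extD θ x v (S.J x v)

/-- The wedge product of two complex covectors, evaluated on two tangent vectors. -/
def wedge {x : M} (α β : TangentSpace (𝓡 3) x →L[ℝ] ℂ) (u v : TangentSpace (𝓡 3) x) : ℂ :=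
  α u * β v - α v * β u

/-- The complex conjugate of a complex covector. -/
def conjForm {x : M} (α : TangentSpace (𝓡 3) x →L[ℝ] ℂ) : TangentSpace (𝓡 3) x →L[ℝ] ℂ :=
  (Complex.conjCLE : ℂ →L[ℝ] ℂ).comp α

/-- A real covector regarded as a complex one. -/
def toComplexForm {x : M} (α : TangentSpace (𝓡 3) x →L[ℝ] ℝ) : TangentSpace (𝓡 3) x →L[ℝ] ℂ :=
  Complex.ofRealCLM.comp α

/-- `θ1` is an admissible unitary coframe on `U`: a smooth complex 1-form `θ¹` of type `(1,0)`,
i.e. `θ¹ ∘ J = i θ¹` on `ξ`, with `dθ = i θ¹ ∧ θ¹̄`. The last equation forces `θ¹` to vanish on the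
characteristic vector field `T` of `θ` and not to vanish on `ξ`, so that `{θ, θ¹, θ¹̄}` is the
coframe dual to `{T, Z₁, Z₁̄}` with `J Z₁ = i Z₁`. -/
structure IsUnitaryCoframeOn [IsManifold (𝓡 3) ∞ M] (S : CRStructure M) (θ : RealOneForm M)
    (θ1 : ComplexOneForm M) (U : Set M) : Prop where
  smooth : SmoothOneFormOn θ1 U
  type : ∀ x ∈ U, ∀ v : S.ξ x, θ1 x (S.J x v) = Complex.I * θ1 x v
  levi : ∀ x ∈ U, ∀ u v : TangentSpace (𝓡 3) x,
    ((extD θ x u v : ℝ) : ℂ) = Complex.I * wedge (θ1 x) (conjForm (θ1 x)) u v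

/-- `om` is the pseudohermitian connection form `ω₁¹` of `(J, θ)` on `U` relative to the coframe
`θ1`: a smooth form with `ω₁¹ + ω₁̄¹̄ = 0` (where `ω₁̄¹̄` is the conjugate of `ω₁¹`) and
`dθ¹ = θ¹ ∧ ω₁¹ + A θ ∧ θ¹̄` for some function `A`, the torsion. -/
structure IsConnectionFormOn [IsManifold (𝓡 3) ∞ M] (θ : RealOneForm M)
    (θ1 om : ComplexOneForm M) (U : Set M) : Prop where
  smooth : SmoothOneFormOn om U
  skew : ∀ x ∈ U, om x + conjForm (om x) = 0
  structure_eq : ∃ A : M → ℂ, ∀ x ∈ U, ∀ u v : TangentSpace (𝓡 3) x,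
    extD θ1 x u v = wedge (θ1 x) (om x) u v
      + A x * wedge (toComplexForm (θ x)) (conjForm (θ1 x)) u v

/-- `w` is the coefficient of `θ¹ ∧ θ¹̄` in `dω₁¹` at the point `x`, i.e.
`dω₁¹ ≡ w θ¹ ∧ θ¹̄` modulo `θ`, for a unitary coframe `θ¹` on a neighbourhood of `x` and its
connection form `ω₁¹`. -/
def IsTanakaWebsterAt [IsManifold (𝓡 3) ∞ M] (S : CRStructure M) (θ : RealOneForm M)
    (x : M) (w : ℝ) : Prop :=
  ∃ U : Set M, IsOpen U ∧ x ∈ U ∧ ∃ θ1 om : ComplexOneForm M,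
    IsUnitaryCoframeOn S θ θ1 U ∧ IsConnectionFormOn θ θ1 om U ∧
    ∀ u ∈ S.ξ x, ∀ v ∈ S.ξ x,
      extD om x u v = w * wedge (θ1 x) (conjForm (θ1 x)) u v

/-- The Tanaka-Webster curvature `W` of the pseudohermitian structure `(J, θ)`. (Unitary coframes
exist around every point, and the coefficient does not depend on the one that is used.) -/
def tanakaWebster [IsManifold (𝓡 3) ∞ M] (S : CRStructure M) (θ : RealOneForm M) (x : M) : ℝ :=
  Classical.epsilon (IsTanakaWebsterAt S θ x)

/-- `θ_t`, `t ∈ I`, is a smooth solution of the (unnormalized) Yamabe flow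
`∂_t θ_t = -2 W_t θ_t`: each `(J, θ_t)` is a positive pseudohermitian structure, and
`θ_t = exp(2 λ_t) θ̂` for a fixed such form `θ̂` and a function `λ` that is smooth on `I × M`. -/
structure IsYamabeFlow [IsManifold (𝓡 3) ∞ M] (S : CRStructure M) (I : Set ℝ)
    (θ : ℝ → RealOneForm M) : Prop where
  pseudohermitian : ∀ t ∈ I, IsPosPseudohermitian S (θ t)
  smooth : ∃ θhat : RealOneForm M, IsPosPseudohermitian S θhat ∧ ∃ lam : ℝ × M → ℝ,
    ContMDiffOn (𝓘(ℝ, ℝ).prod (𝓡 3)) 𝓘(ℝ, ℝ) ∞ lam (I ×ˢ univ) ∧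
    ∀ t ∈ I, ∀ x : M, θ t x = Real.exp (2 * lam (t, x)) • θhat x
  evolution : ∀ t ∈ I, ∀ (x : M) (v : TangentSpace (𝓡 3) x),
    HasDerivWithinAt (fun s => θ s x v) (-2 * tanakaWebster S (θ t) x * θ t x v) I t

end PseudohermitianGeometry

/-!
Write `θ_t = e^{2λ} θ̂`. The flow equation says `∂ₜ λ = -W`, and `W` obeys the conformal law
`W = e^{-2λ} (Ŵ - 2 (XXλ + YYλ) - 2 ((Xλ)² + (Yλ)²) + first order terms in λ)`, where `X, Y = JX` is
a local frame of `ξ` with `dθ̂(X, Y) = 2`. Differentiating the law in time, with `∂ₜ λ = -W`, gives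
`∂ₜ W = 2 W² + 2 e^{-2λ} (XXW + YYW) + first order terms in W`. At a spatial minimum of `W` the
first order terms vanish and the second order ones are nonnegative, so that `∂ₜ W ≥ 0` there
(`exists_hasDerivAt_of_isMin`). The maximum principle, applied to `W + ε t` on the compact set
`[0, t₂] × M`, then keeps `W` above its initial minimum.

The conformal law, together with the existence and uniqueness of the curvature that it presupposes,
is proved in a chart, with the real and imaginary parts of the complex forms: a unitary coframe is
`θ¹ = α₁ + i α₂` and its connection form is `i ρ` (`IsRealCoframe`). In these terms
`dΘ = 2 α₁ ∧ α₂`, and the curvature is `w` in `dρ ≡ -2 w α₁ ∧ α₂` modulo `Θ`.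
* Existence of `ρ`: the structure equations determine it, and are solvable as `d(dΘ) = 0`
  (`IsReebFrame.exists_connection`).
* Uniqueness of `w`: two unitary coframes differ by a rotation `(p, q)` and their connection forms
  by the closed form `q dp - p dq` (`IsReebFrame.isFlatTanakaWebsterAt_unique`).
* Conformal law: a unitary coframe of `e^{2f} Θ` and its connection form are written down in terms
  of those of `Θ` (`IsReebFrame.conformal_connection`).

The definitions on the manifold are related to those in the chart by the invariance of the exterior
derivative under changes of charts (`extD_chartDSymm`).
-/

/-! ### Exterior derivatives of 1-forms on a normed space -/

section LocalCalculus

variable {E F G : Type*} [NormedAddCommGroup E] [NormedSpace ℝ E]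
  [NormedAddCommGroup F] [NormedSpace ℝ F] [NormedAddCommGroup G] [NormedSpace ℝ G]

/-- The exterior derivative of a 1-form on a normed space. -/
noncomputable def flatExtD (β : E → E →L[ℝ] F) (y u v : E) : F :=
  fderiv ℝ β y u v - fderiv ℝ β y v u

lemma flatExtD_add_left (β : E → E →L[ℝ] F) (y u u' v : E) :
    flatExtD β y (u + u') v = flatExtD β y u v + flatExtD β y u' v := by
  simp only [flatExtD, map_add, add_apply]; abel

lemma flatExtD_smul_left (β : E → E →L[ℝ] F) (y : E) (c : ℝ) (u v : E) :
    flatExtD β y (c • u) v = c • flatExtD β y u v := by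
  simp only [flatExtD, map_smul, smul_apply, smul_sub]

lemma flatExtD_swap (β : E → E →L[ℝ] F) (y u v : E) :
    flatExtD β y v u = -flatExtD β y u v := by
  simp only [flatExtD]; abel

lemma flatExtD_self (β : E → E →L[ℝ] F) (y u : E) : flatExtD β y u u = 0 := by
  simp [flatExtD]

lemma flatExtD_add_right (β : E → E →L[ℝ] F) (y u v v' : E) :
    flatExtD β y u (v + v') = flatExtD β y u v + flatExtD β y u v' := by
  simp only [flatExtD, map_add, add_apply]; abel

lemma flatExtD_smul_right (β : E → E →L[ℝ] F) (y : E) (c : ℝ) (u v : E) :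
    flatExtD β y u (c • v) = c • flatExtD β y u v := by
  simp only [flatExtD, map_smul, smul_apply, smul_sub]

lemma flatExtD_add {β γ : E → E →L[ℝ] F} {y : E} (hβ : DifferentiableAt ℝ β y)
    (hγ : DifferentiableAt ℝ γ y) (u v : E) :
    flatExtD (fun z => β z + γ z) y u v = flatExtD β y u v + flatExtD γ y u v := by
  simp only [flatExtD, fderiv_fun_add hβ hγ, add_apply]; abel

lemma flatExtD_sub {β γ : E → E →L[ℝ] F} {y : E} (hβ : DifferentiableAt ℝ β y)
    (hγ : DifferentiableAt ℝ γ y) (u v : E) :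
    flatExtD (fun z => β z - γ z) y u v = flatExtD β y u v - flatExtD γ y u v := by
  simp only [flatExtD, fderiv_fun_sub hβ hγ, sub_apply]; abel

lemma flatExtD_smul {f : E → ℝ} {β : E → E →L[ℝ] F} {y : E} (hf : DifferentiableAt ℝ f y)
    (hβ : DifferentiableAt ℝ β y) (u v : E) :
    flatExtD (fun z => f z • β z) y u v =
      fderiv ℝ f y u • β y v - fderiv ℝ f y v • β y u + f y • flatExtD β y u v := by
  simp only [flatExtD, fderiv_fun_smul hf hβ, add_apply, smul_apply,
    ContinuousLinearMap.smulRight_apply, smul_sub]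
  abel

lemma flatExtD_clm_comp (L : F →L[ℝ] G) {β : E → E →L[ℝ] F} {y : E}
    (hβ : DifferentiableAt ℝ β y) (u v : E) :
    flatExtD (fun z => L.comp (β z)) y u v = L (flatExtD β y u v) := by
  have h : fderiv ℝ (fun z => L.comp (β z)) y
      = (ContinuousLinearMap.compL ℝ E F G L).comp (fderiv ℝ β y) :=
    ((ContinuousLinearMap.compL ℝ E F G L).hasFDerivAt.comp y hβ.hasFDerivAt).fderiv
  simp [flatExtD, h]

lemma flatExtD_congr {β γ : E → E →L[ℝ] F} {y : E} (h : β =ᶠ[𝓝 y] γ) (u v : E) :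
    flatExtD β y u v = flatExtD γ y u v := by
  simp only [flatExtD, h.fderiv_eq]

lemma two_le_infty : (2 : WithTop ℕ∞) ≤ ∞ := WithTop.coe_le_coe.2 le_top

lemma flatExtD_fderiv {f : E → ℝ} {y : E} (hf : ContDiffAt ℝ ∞ f y) (u v : E) :
    flatExtD (fderiv ℝ f) y u v = 0 := by
  have h : IsSymmSndFDerivAt ℝ f y := hf.isSymmSndFDerivAt (by simpa using two_le_infty)
  rw [flatExtD, h.eq u v, sub_self]

/-- `d(dβ) = 0`, for constant vector fields. -/
lemma flatExtD_closed {β : E → E →L[ℝ] ℝ} {y : E} (hβ : ContDiffAt ℝ ∞ β y) (u v w : E) :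
    fderiv ℝ (fun z => flatExtD β z v w) y u + fderiv ℝ (fun z => flatExtD β z w u) y v
      + fderiv ℝ (fun z => flatExtD β z u v) y w = 0 := by
  have h : IsSymmSndFDerivAt ℝ β y := hβ.isSymmSndFDerivAt (by simpa using two_le_infty)
  have hd : DifferentiableAt ℝ (fderiv ℝ β) y :=
    (hβ.fderiv_right (m := ∞) (by simp)).differentiableAt (by simp)
  have key : ∀ a b c : E, fderiv ℝ (fun z => flatExtD β z a b) y c
      = fderiv ℝ (fderiv ℝ β) y c a b - fderiv ℝ (fderiv ℝ β) y c b a := by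
    intro a b c
    have h1 : ∀ a b : E, HasFDerivAt (fun z => fderiv ℝ β z a b)
        ((fderiv ℝ (fderiv ℝ β) y).flip a |>.flip b) y := by
      intro a b
      refine ((hd.hasFDerivAt.clm_apply (hasFDerivAt_const a y)).clm_apply
        (hasFDerivAt_const b y)).congr_fderiv ?_
      ext c; simp
    have := ((h1 a b).sub (h1 b a)).fderiv
    simp only [flatExtD]
    erw [this]; simp
  rw [key, key, key, h.eq u v, h.eq v w, h.eq w u]; ring

end LocalCalculus

/-! ### Frames, unitary coframes and the Tanaka-Webster curvature in coordinates -/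

section Frames

variable {E : Type*} [NormedAddCommGroup E] [NormedSpace ℝ E]

/-- On the open set `V`, the fields `T, X, Y` form a smooth frame with dual coframe `Θ, e₁, e₂`, and
`dΘ = 2 e₁ ∧ e₂`. In particular `T` is the characteristic vector field of `Θ`. -/
structure IsReebFrame (Θ e₁ e₂ : E → E →L[ℝ] ℝ) (T X Y : E → E) (V : Set E) : Prop where
  isOpen : IsOpen V
  smooth_form : ContDiffOn ℝ ∞ Θ V
  smooth₁ : ContDiffOn ℝ ∞ e₁ V
  smooth₂ : ContDiffOn ℝ ∞ e₂ V
  smooth_T : ContDiffOn ℝ ∞ T V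
  smooth_X : ContDiffOn ℝ ∞ X V
  smooth_Y : ContDiffOn ℝ ∞ Y V
  expand : ∀ y ∈ V, ∀ v, v = Θ y v • T y + e₁ y v • X y + e₂ y v • Y y
  form_T : ∀ y ∈ V, Θ y (T y) = 1
  form_X : ∀ y ∈ V, Θ y (X y) = 0
  form_Y : ∀ y ∈ V, Θ y (Y y) = 0
  e₁_T : ∀ y ∈ V, e₁ y (T y) = 0
  e₁_X : ∀ y ∈ V, e₁ y (X y) = 1
  e₁_Y : ∀ y ∈ V, e₁ y (Y y) = 0
  e₂_T : ∀ y ∈ V, e₂ y (T y) = 0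
  e₂_X : ∀ y ∈ V, e₂ y (X y) = 0
  e₂_Y : ∀ y ∈ V, e₂ y (Y y) = 1
  levi : ∀ y ∈ V, ∀ u v, flatExtD Θ y u v = 2 * (e₁ y u * e₂ y v - e₁ y v * e₂ y u)

/-- The real form of a unitary coframe `θ¹ = α₁ + i α₂` of `Θ` on `V` and its connection form
`ω₁¹ = i ρ`. The frame `X, Y` of `ker Θ` stands for the CR structure: `J X = Y`. -/
structure IsRealCoframe (X Y : E → E) (Θ α₁ α₂ ρ : E → E →L[ℝ] ℝ) (V : Set E) : Prop where
  smooth₁ : ContDiffOn ℝ ∞ α₁ V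
  smooth₂ : ContDiffOn ℝ ∞ α₂ V
  smooth_conn : ContDiffOn ℝ ∞ ρ V
  type₁ : ∀ y ∈ V, α₁ y (Y y) = -α₂ y (X y)
  type₂ : ∀ y ∈ V, α₂ y (Y y) = α₁ y (X y)
  levi : ∀ y ∈ V, ∀ u v, flatExtD Θ y u v = 2 * (α₁ y u * α₂ y v - α₁ y v * α₂ y u)
  structure_eq : ∀ y ∈ V, ∃ a b : ℝ, ∀ u v,
    flatExtD α₁ y u v = -(α₂ y u * ρ y v - α₂ y v * ρ y u)
      + a * (Θ y u * α₁ y v - Θ y v * α₁ y u) + b * (Θ y u * α₂ y v - Θ y v * α₂ y u) ∧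
    flatExtD α₂ y u v = (α₁ y u * ρ y v - α₁ y v * ρ y u)
      + b * (Θ y u * α₁ y v - Θ y v * α₁ y u) - a * (Θ y u * α₂ y v - Θ y v * α₂ y u)

/-- The coordinate form of `IsTanakaWebsterAt`: `w` is determined by `dρ = -2 w α₁ ∧ α₂` on
`ker Θ`, at `y₀`. -/
def IsFlatTanakaWebsterAt (X Y : E → E) (Θ : E → E →L[ℝ] ℝ) (y₀ : E) (w : ℝ) : Prop :=
  ∃ V : Set E, IsOpen V ∧ y₀ ∈ V ∧ ∃ α₁ α₂ ρ : E → E →L[ℝ] ℝ, IsRealCoframe X Y Θ α₁ α₂ ρ V ∧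
    flatExtD ρ y₀ (X y₀) (Y y₀)
      = -2 * w * (α₁ y₀ (X y₀) * α₂ y₀ (Y y₀) - α₁ y₀ (Y y₀) * α₂ y₀ (X y₀))

variable {Θ e₁ e₂ ρ : E → E →L[ℝ] ℝ} {T X Y : E → E} {V : Set E} {y : E}

lemma IsReebFrame.mono (h : IsReebFrame Θ e₁ e₂ T X Y V) {V' : Set E} (hV' : IsOpen V')
    (hs : V' ⊆ V) : IsReebFrame Θ e₁ e₂ T X Y V' where
  isOpen := hV'
  smooth_form := h.smooth_form.mono hs
  smooth₁ := h.smooth₁.mono hs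
  smooth₂ := h.smooth₂.mono hs
  smooth_T := h.smooth_T.mono hs
  smooth_X := h.smooth_X.mono hs
  smooth_Y := h.smooth_Y.mono hs
  expand y hy := h.expand y (hs hy)
  form_T y hy := h.form_T y (hs hy)
  form_X y hy := h.form_X y (hs hy)
  form_Y y hy := h.form_Y y (hs hy)
  e₁_T y hy := h.e₁_T y (hs hy)
  e₁_X y hy := h.e₁_X y (hs hy)
  e₁_Y y hy := h.e₁_Y y (hs hy)
  e₂_T y hy := h.e₂_T y (hs hy)
  e₂_X y hy := h.e₂_X y (hs hy)
  e₂_Y y hy := h.e₂_Y y (hs hy)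
  levi y hy := h.levi y (hs hy)

lemma IsRealCoframe.mono {α₁ α₂ : E → E →L[ℝ] ℝ} (h : IsRealCoframe X Y Θ α₁ α₂ ρ V)
    {V' : Set E} (hs : V' ⊆ V) : IsRealCoframe X Y Θ α₁ α₂ ρ V' where
  smooth₁ := h.smooth₁.mono hs
  smooth₂ := h.smooth₂.mono hs
  smooth_conn := h.smooth_conn.mono hs
  type₁ y hy := h.type₁ y (hs hy)
  type₂ y hy := h.type₂ y (hs hy)
  levi y hy := h.levi y (hs hy)
  structure_eq y hy := h.structure_eq y (hs hy)

lemma ContDiffOn.differentiableAt_of_mem {F : Type*} [NormedAddCommGroup F] [NormedSpace ℝ F]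
    {f : E → F} (hf : ContDiffOn ℝ ∞ f V) (hV : IsOpen V) (hy : y ∈ V) :
    DifferentiableAt ℝ f y :=
  (hf.contDiffAt (hV.mem_nhds hy)).differentiableAt (by simp)

lemma ContDiffOn.fderiv_smooth {F : Type*} [NormedAddCommGroup F] [NormedSpace ℝ F]
    {f : E → F} (hf : ContDiffOn ℝ ∞ f V) (hV : IsOpen V) :
    ContDiffOn ℝ ∞ (fderiv ℝ f) V :=
  hf.fderiv_of_isOpen hV (by simp)

lemma ContDiffOn.flatExtD_smooth {F : Type*} [NormedAddCommGroup F] [NormedSpace ℝ F]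
    {β : E → E →L[ℝ] F} (hβ : ContDiffOn ℝ ∞ β V) (hV : IsOpen V) {A B : E → E}
    (hA : ContDiffOn ℝ ∞ A V) (hB : ContDiffOn ℝ ∞ B V) :
    ContDiffOn ℝ ∞ (fun y => flatExtD β y (A y) (B y)) V :=
  (((hβ.fderiv_smooth hV).clm_apply hA).clm_apply hB).sub
    (((hβ.fderiv_smooth hV).clm_apply hB).clm_apply hA)

namespace IsReebFrame

variable (h : IsReebFrame Θ e₁ e₂ T X Y V)
include h

lemma expand_form {F : Type*} [NormedAddCommGroup F] [NormedSpace ℝ F]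
    (hy : y ∈ V) (β : E →L[ℝ] F) (v : E) :
    β v = Θ y v • β (T y) + e₁ y v • β (X y) + e₂ y v • β (Y y) := by
  conv_lhs => rw [h.expand y hy v]
  simp

lemma expand_flatExtD (hy : y ∈ V) (β : E → E →L[ℝ] ℝ) (u v : E) :
    flatExtD β y u v
      = flatExtD β y (T y) (X y) * (Θ y u * e₁ y v - Θ y v * e₁ y u)
      + flatExtD β y (T y) (Y y) * (Θ y u * e₂ y v - Θ y v * e₂ y u)
      + flatExtD β y (X y) (Y y) * (e₁ y u * e₂ y v - e₁ y v * e₂ y u) := by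
  conv_lhs => rw [h.expand y hy u, h.expand y hy v]
  simp only [flatExtD_add_left, flatExtD_add_right, flatExtD_smul_left, flatExtD_smul_right,
    flatExtD_self, flatExtD_swap β y (T y) (X y), flatExtD_swap β y (T y) (Y y),
    flatExtD_swap β y (X y) (Y y), smul_eq_mul]
  ring

/-- The torsion of the coframe `e₁ + i e₂` is symmetric, a consequence of `d(dΘ) = 0`. -/
lemma torsion_trace (hy : y ∈ V) :
    flatExtD e₁ y (T y) (X y) + flatExtD e₂ y (T y) (Y y) = 0 := by
  have d1 := h.smooth₁.differentiableAt_of_mem h.isOpen hy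
  have d2 := h.smooth₂.differentiableAt_of_mem h.isOpen hy
  have key : ∀ a b c : E, fderiv ℝ (fun z => flatExtD Θ z a b) y c
      = 2 * (fderiv ℝ e₁ y c a * e₂ y b + e₁ y a * fderiv ℝ e₂ y c b
        - (fderiv ℝ e₁ y c b * e₂ y a + e₁ y b * fderiv ℝ e₂ y c a)) := by
    intro a b c
    have he : (fun z => flatExtD Θ z a b)
        =ᶠ[𝓝 y] fun z => 2 * (e₁ z a * e₂ z b - e₁ z b * e₂ z a) := by
      filter_upwards [h.isOpen.mem_nhds hy] with z hz using h.levi z hz a b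
    have hc : ∀ {β : E → E →L[ℝ] ℝ} (a : E), DifferentiableAt ℝ β y →
        HasFDerivAt (fun z => β z a) ((fderiv ℝ β y).flip a) y := by
      intro β a hβ
      refine (hβ.hasFDerivAt.clm_apply (hasFDerivAt_const a y)).congr_fderiv ?_
      ext c; simp
    have := ((((hc a d1).mul (hc b d2)).sub ((hc b d1).mul (hc a d2))).const_mul 2).fderiv
    rw [he.fderiv_eq]
    erw [this]
    simp; ring
  have := flatExtD_closed (h.smooth_form.contDiffAt (h.isOpen.mem_nhds hy)) (T y) (X y) (Y y)
  rw [key, key, key, h.e₁_T y hy, h.e₁_X y hy, h.e₁_Y y hy, h.e₂_T y hy, h.e₂_X y hy,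
    h.e₂_Y y hy] at this
  simp only [flatExtD]
  linarith

/-- The coframe `e₁ + i e₂` is unitary and has a connection form. The components of `ρ` are read off
from the structure equations; they are consistent because of `torsion_trace`. -/
lemma exists_connection : ∃ ρ : E → E →L[ℝ] ℝ, IsRealCoframe X Y Θ e₁ e₂ ρ V := by
  refine ⟨fun y => flatExtD e₁ y (X y) (Y y) • e₁ y + flatExtD e₂ y (X y) (Y y) • e₂ y
    + ((1 / 2 : ℝ) * (flatExtD e₁ y (T y) (Y y) - flatExtD e₂ y (T y) (X y))) • Θ y,
    ⟨h.smooth₁, h.smooth₂, ?_, ?_, ?_, h.levi, ?_⟩⟩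
  · have s1 := h.smooth₁.flatExtD_smooth h.isOpen h.smooth_X h.smooth_Y
    have s2 := h.smooth₂.flatExtD_smooth h.isOpen h.smooth_X h.smooth_Y
    have s3 := h.smooth₁.flatExtD_smooth h.isOpen h.smooth_T h.smooth_Y
    have s4 := h.smooth₂.flatExtD_smooth h.isOpen h.smooth_T h.smooth_X
    exact ((s1.smul h.smooth₁).add (s2.smul h.smooth₂)).add
      ((contDiffOn_const.mul (s3.sub s4)).smul h.smooth_form)
  · intro y hy; rw [h.e₁_Y y hy, h.e₂_X y hy, neg_zero]
  · intro y hy; rw [h.e₁_X y hy, h.e₂_Y y hy]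
  · intro y hy
    have ht := h.torsion_trace hy
    refine ⟨flatExtD e₁ y (T y) (X y),
      (1 / 2 : ℝ) * (flatExtD e₁ y (T y) (Y y) + flatExtD e₂ y (T y) (X y)), fun u v => ⟨?_, ?_⟩⟩
    · rw [h.expand_flatExtD hy e₁ u v]
      simp only [add_apply, smul_apply, smul_eq_mul]
      ring
    · rw [h.expand_flatExtD hy e₂ u v]
      simp only [add_apply, smul_apply, smul_eq_mul]
      linear_combination (Θ y u * e₂ y v - Θ y v * e₂ y u) * ht

/-- The curvature at `y` does not depend on the unitary coframe. Any two unitary coframes differ by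
a rotation `(p, q)`, and their connection forms by the closed form `q dp - p dq`. -/
lemma isFlatTanakaWebsterAt_unique {ρ : E → E →L[ℝ] ℝ} (hρ : IsRealCoframe X Y Θ e₁ e₂ ρ V)
    (hy : y ∈ V) {w : ℝ} (hw : IsFlatTanakaWebsterAt X Y Θ y w) :
    flatExtD ρ y (X y) (Y y) = -2 * w := by
  obtain ⟨V', hV', hyV', α₁, α₂, η, hα, hη⟩ := hw
  have hV'' := h.isOpen.inter hV'
  replace hα := hα.mono (inter_subset_right : V ∩ V' ⊆ V')
  replace hρ := hρ.mono (inter_subset_left : V ∩ V' ⊆ V)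
  replace h := h.mono hV'' inter_subset_left
  replace hy : y ∈ V ∩ V' := ⟨hy, hyV'⟩
  set U := V ∩ V'
  set p : E → ℝ := fun z => α₁ z (X z) with hp
  set q : E → ℝ := fun z => α₂ z (X z) with hq
  have sp : ContDiffOn ℝ ∞ p U := hα.smooth₁.clm_apply h.smooth_X
  have sq : ContDiffOn ℝ ∞ q U := hα.smooth₂.clm_apply h.smooth_X
  have hpq : ∀ z ∈ U, p z ^ 2 + q z ^ 2 = 1 := by
    intro z hz
    have h1 := hα.levi z hz (X z) (Y z)
    rw [h.levi z hz, h.e₁_X z hz, h.e₂_Y z hz, h.e₁_Y z hz, hα.type₁ z hz, hα.type₂ z hz] at h1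
    simp only [hp, hq]; linarith
  -- `T` spans the kernel of `dΘ`, so both real parts of any unitary coframe vanish on it
  have hT : ∀ z ∈ U, α₁ z (T z) = 0 ∧ α₂ z (T z) = 0 := by
    intro z hz
    have h0 := hpq z hz
    have h1 := hα.levi z hz (T z) (X z)
    have h2 := hα.levi z hz (T z) (Y z)
    rw [h.levi z hz, h.e₁_T z hz, h.e₂_T z hz] at h1 h2
    rw [hα.type₁ z hz, hα.type₂ z hz] at h2
    simp only [hp, hq] at h0
    constructor
    · linear_combination (-α₁ z (T z)) * h0 - α₂ z (X z) / 2 * h1 - α₁ z (X z) / 2 * h2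
    · linear_combination (-α₂ z (T z)) * h0 + α₁ z (X z) / 2 * h1 - α₂ z (X z) / 2 * h2
  have r1 : ∀ z ∈ U, α₁ z = p z • e₁ z - q z • e₂ z := by
    intro z hz; ext v
    rw [h.expand_form hz (α₁ z) v, (hT z hz).1, hα.type₁ z hz]
    simp [hp, hq]; ring
  have r2 : ∀ z ∈ U, α₂ z = q z • e₁ z + p z • e₂ z := by
    intro z hz; ext v
    rw [h.expand_form hz (α₂ z) v, (hT z hz).2, hα.type₂ z hz]
    simp [hp, hq]; ring
  have hmem : ∀ {z}, z ∈ U → U ∈ 𝓝 z := fun hz => hV''.mem_nhds hz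
  have hdpq : ∀ z ∈ U, ∀ v, p z * fderiv ℝ p z v + q z * fderiv ℝ q z v = 0 := by
    intro z hz v
    have dp := (sp.differentiableAt_of_mem hV'' hz).hasFDerivAt
    have dq := (sq.differentiableAt_of_mem hV'' hz).hasFDerivAt
    have he : (fun z => p z * p z + q z * q z) =ᶠ[𝓝 z] fun _ => (1 : ℝ) := by
      filter_upwards [hmem hz] with x hx
      have := hpq x hx; nlinarith
    have h1 := he.fderiv_eq (𝕜 := ℝ)
    have h2 := ((dp.mul dp).add (dq.mul dq)).fderiv
    erw [h2] at h1
    have := congrArg (fun L : E →L[ℝ] ℝ => L v) h1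
    simp at this
    linarith
  have hη' : ∀ z ∈ U, η z = ρ z + (q z • fderiv ℝ p z - p z • fderiv ℝ q z) := by
    intro z hz
    have dp := sp.differentiableAt_of_mem hV'' hz
    have dq := sq.differentiableAt_of_mem hV'' hz
    have d1 := h.smooth₁.differentiableAt_of_mem hV'' hz
    have d2 := h.smooth₂.differentiableAt_of_mem hV'' hz
    obtain ⟨a, b, hab⟩ := hρ.structure_eq z hz
    obtain ⟨a', b', hab'⟩ := hα.structure_eq z hz
    have D1 : ∀ u v, flatExtD α₁ z u v = fderiv ℝ p z u * e₁ z v - fderiv ℝ p z v * e₁ z u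
        + p z * flatExtD e₁ z u v - (fderiv ℝ q z u * e₂ z v - fderiv ℝ q z v * e₂ z u
        + q z * flatExtD e₂ z u v) := by
      intro u v
      rw [flatExtD_congr (Filter.eventuallyEq_of_mem (hmem hz) r1),
        flatExtD_sub (dp.fun_smul d1) (dq.fun_smul d2), flatExtD_smul dp d1, flatExtD_smul dq d2]
      simp only [smul_eq_mul]
    have D2 : ∀ u v, flatExtD α₂ z u v = fderiv ℝ q z u * e₁ z v - fderiv ℝ q z v * e₁ z u
        + q z * flatExtD e₁ z u v + (fderiv ℝ p z u * e₂ z v - fderiv ℝ p z v * e₂ z u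
        + p z * flatExtD e₂ z u v) := by
      intro u v
      rw [flatExtD_congr (Filter.eventuallyEq_of_mem (hmem hz) r2),
        flatExtD_add (dq.fun_smul d1) (dp.fun_smul d2), flatExtD_smul dq d1, flatExtD_smul dp d2]
      simp only [smul_eq_mul]
    have h0 := hpq z hz
    have eT1 := h.e₁_T z hz
    have eX1 := h.e₁_X z hz
    have eY1 := h.e₁_Y z hz
    have eT2 := h.e₂_T z hz
    have eX2 := h.e₂_X z hz
    have eY2 := h.e₂_Y z hz
    have tT := h.form_T z hz
    have tX := h.form_X z hz
    have tY := h.form_Y z hz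
    have A1 : ∀ v, α₁ z v = p z * e₁ z v - q z * e₂ z v := fun v => by rw [r1 z hz]; simp
    have A2 : ∀ v, α₂ z v = q z * e₁ z v + p z * e₂ z v := fun v => by rw [r2 z hz]; simp
    -- the structure equations of the rotated coframe, component by component
    have TX1 := (hab' (T z) (X z)).1
    have TX2 := (hab' (T z) (X z)).2
    have TY1 := (hab' (T z) (Y z)).1
    have TY2 := (hab' (T z) (Y z)).2
    have XY1 := (hab' (X z) (Y z)).1
    have XY2 := (hab' (X z) (Y z)).2
    simp only [D1, D2, (hab _ _).1, (hab _ _).2, A1, A2, eT1, eX1, eY1, eT2, eX2, eY2, tT, tX, tY,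
      mul_zero, mul_one, zero_mul, sub_zero, zero_sub, add_zero, zero_add, neg_zero, one_mul]
      at TX1 TX2 TY1 TY2 XY1 XY2
    have dT := hdpq z hz (T z)
    have dX := hdpq z hz (X z)
    have dY := hdpq z hz (Y z)
    have hTT : η z (T z) = ρ z (T z) + (q z * fderiv ℝ p z (T z) - p z * fderiv ℝ q z (T z)) := by
      linear_combination (-(1 / 2 : ℝ)) * (q z * TX1 + p z * TY1 - p z * TX2 + q z * TY2)
        - (η z (T z) - ρ z (T z)) * h0
    have hXX : η z (X z) = ρ z (X z) + (q z * fderiv ℝ p z (X z) - p z * fderiv ℝ q z (X z)) := by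
      linear_combination -(p z * XY1 + q z * XY2) - dY - (η z (X z) - ρ z (X z)) * h0
    have hYY : η z (Y z) = ρ z (Y z) + (q z * fderiv ℝ p z (Y z) - p z * fderiv ℝ q z (Y z)) := by
      linear_combination -(-q z * XY1 + p z * XY2) + dX - (η z (Y z) - ρ z (Y z)) * h0
    ext v
    rw [h.expand_form hz (η z) v, hTT, hXX, hYY,
      h.expand_form hz (ρ z + (q z • fderiv ℝ p z - p z • fderiv ℝ q z)) v]
    simp
  have dp := sp.differentiableAt_of_mem hV'' hy
  have dq := sq.differentiableAt_of_mem hV'' hy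
  have dp' := (sp.fderiv_smooth hV'').differentiableAt_of_mem hV'' hy
  have dq' := (sq.fderiv_smooth hV'').differentiableAt_of_mem hV'' hy
  have dρ := hρ.smooth_conn.differentiableAt_of_mem hV'' hy
  have h0 := hpq y hy
  have dX := hdpq y hy (X y)
  have dY := hdpq y hy (Y y)
  rw [flatExtD_congr (Filter.eventuallyEq_of_mem (hmem hy) hη'),
    flatExtD_add dρ ((dq.fun_smul dp').fun_sub (dp.fun_smul dq')),
    flatExtD_sub (dq.fun_smul dp') (dp.fun_smul dq'), flatExtD_smul dq dp', flatExtD_smul dp dq',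
    flatExtD_fderiv (sp.contDiffAt (hmem hy)), flatExtD_fderiv (sq.contDiffAt (hmem hy)),
    hα.type₁ y hy, hα.type₂ y hy] at hη
  simp only [smul_eq_mul, mul_zero, add_zero] at hη
  -- `q dp - p dq` is closed: `dp` and `dq` are proportional, as `p dp + q dq = 0`
  have hD : fderiv ℝ q y (X y) * fderiv ℝ p y (Y y) - fderiv ℝ q y (Y y) * fderiv ℝ p y (X y)
      = 0 := by
    linear_combination (-(fderiv ℝ q y (X y) * fderiv ℝ p y (Y y)
      - fderiv ℝ q y (Y y) * fderiv ℝ p y (X y))) * h0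
      + p y * (fderiv ℝ q y (X y) * dY - fderiv ℝ q y (Y y) * dX)
      + q y * (fderiv ℝ p y (Y y) * dX - fderiv ℝ p y (X y) * dY)
  simp only [hp, hq] at h0
  linear_combination hη - 2 * hD - 2 * w * h0

end IsReebFrame

end Frames

/-! ### Conformal change of the contact form -/

section Conformal

variable {E : Type*} [NormedAddCommGroup E] [NormedSpace ℝ E]
variable {Θ e₁ e₂ ρ : E → E →L[ℝ] ℝ} {T X Y : E → E} {V : Set E} {y : E} {f : E → ℝ}

/-- The derivative of a function along a vector field. -/
noncomputable def dirDeriv (X : E → E) (f : E → ℝ) (y : E) : ℝ := fderiv ℝ f y (X y)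

lemma ContDiffOn.dirDeriv_smooth (hf : ContDiffOn ℝ ∞ f V) (hX : ContDiffOn ℝ ∞ X V)
    (hV : IsOpen V) : ContDiffOn ℝ ∞ (dirDeriv X f) V :=
  (hf.fderiv_smooth hV).clm_apply hX

/-- The frame `X, Y` matters only up to a common factor: it serves to express the complex
structure. -/
lemma IsFlatTanakaWebsterAt.smul_frame {w : ℝ} (hw : IsFlatTanakaWebsterAt X Y Θ y w) (g : E → ℝ) :
    IsFlatTanakaWebsterAt (fun z => g z • X z) (fun z => g z • Y z) Θ y w := by
  obtain ⟨U, hU, hyU, α₁, α₂, ρ, hα, hρ⟩ := hw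
  refine ⟨U, hU, hyU, α₁, α₂, ρ, ⟨hα.smooth₁, hα.smooth₂, hα.smooth_conn, ?_, ?_, hα.levi,
    hα.structure_eq⟩, ?_⟩
  · intro z hz; simp [hα.type₁ z hz]
  · intro z hz; simp [hα.type₂ z hz]
  · simp only [flatExtD_smul_left, flatExtD_smul_right, hρ, map_smul, smul_eq_mul]; ring

namespace IsReebFrame

variable (h : IsReebFrame Θ e₁ e₂ T X Y V) (hf : ContDiffOn ℝ ∞ f V)
include h hf

/-- A frame and coframe as in `IsReebFrame`, with the same complex structure, for `e^{2f} Θ`. -/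
lemma conformal : IsReebFrame (fun z => Real.exp (2 * f z) • Θ z)
    (fun z => Real.exp (f z) • (e₁ z - dirDeriv Y f z • Θ z))
    (fun z => Real.exp (f z) • (e₂ z + dirDeriv X f z • Θ z))
    (fun z => Real.exp (-2 * f z) • (T z + dirDeriv Y f z • X z - dirDeriv X f z • Y z))
    (fun z => Real.exp (-f z) • X z) (fun z => Real.exp (-f z) • Y z) V := by
  have sX := hf.dirDeriv_smooth h.smooth_X h.isOpen
  have sY := hf.dirDeriv_smooth h.smooth_Y h.isOpen
  have hE : ∀ z, Real.exp (f z) * Real.exp (-f z) = 1 := fun z => by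
    rw [← Real.exp_add]; simp
  have hE2 : ∀ z, Real.exp (2 * f z) = Real.exp (f z) * Real.exp (f z) := fun z => by
    rw [← Real.exp_add]; congr 1; ring
  have hE3 : ∀ z, Real.exp (-2 * f z) = Real.exp (-f z) * Real.exp (-f z) := fun z => by
    rw [← Real.exp_add]; congr 1; ring
  constructor
  · exact h.isOpen
  · exact (contDiffOn_const.mul hf).exp.smul h.smooth_form
  · exact hf.exp.smul (h.smooth₁.sub (sY.smul h.smooth_form))
  · exact hf.exp.smul (h.smooth₂.add (sX.smul h.smooth_form))
  · exact (contDiffOn_const.mul hf).exp.smul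
      ((h.smooth_T.add (sY.smul h.smooth_X)).sub (sX.smul h.smooth_Y))
  · exact hf.neg.exp.smul h.smooth_X
  · exact hf.neg.exp.smul h.smooth_Y
  · intro z hz v
    have h1 := hE z
    conv_lhs => rw [h.expand z hz v]
    simp only [smul_apply, sub_apply, add_apply, smul_eq_mul, hE2, hE3, smul_smul]
    have e1 : ∀ a : ℝ, Real.exp (f z) * Real.exp (f z) * a * (Real.exp (-f z) * Real.exp (-f z))
      = a := fun a => by linear_combination a * (Real.exp (f z) * Real.exp (-f z) + 1) * h1
    have e2 : ∀ a : ℝ, Real.exp (f z) * a * Real.exp (-f z) = a := fun a => by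
      linear_combination a * h1
    rw [e1, e2, e2]; module
  all_goals intro z hz
  · simp [h.form_T z hz, h.form_X z hz, h.form_Y z hz, ← Real.exp_add]
  · simp [h.form_X z hz]
  · simp [h.form_Y z hz]
  · simp [h.form_T z hz, h.form_X z hz, h.form_Y z hz, h.e₁_T z hz, h.e₁_X z hz, h.e₁_Y z hz]
  · simp [h.form_X z hz, h.e₁_X z hz, ← Real.exp_add]
  · simp [h.form_Y z hz, h.e₁_Y z hz]
  · simp [h.form_T z hz, h.form_X z hz, h.form_Y z hz, h.e₂_T z hz, h.e₂_X z hz, h.e₂_Y z hz]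
  · simp [h.form_X z hz, h.e₂_X z hz]
  · simp [h.form_Y z hz, h.e₂_Y z hz, ← Real.exp_add]
  · intro u v
    have dE : HasFDerivAt (fun z => Real.exp (2 * f z))
        (Real.exp (2 * f z) • ((2 : ℝ) • fderiv ℝ f z)) z :=
      ((hf.differentiableAt_of_mem h.isOpen hz).hasFDerivAt.const_mul 2).exp
    rw [flatExtD_smul dE.differentiableAt (h.smooth_form.differentiableAt_of_mem h.isOpen hz),
      dE.fderiv, h.levi z hz, hE2]
    simp only [smul_apply, sub_apply, add_apply, smul_eq_mul]
    rw [h.expand_form hz (fderiv ℝ f z) u, h.expand_form hz (fderiv ℝ f z) v]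
    simp only [smul_eq_mul, dirDeriv]
    ring

/-- The commutator `[X, Y] = -2 T - ρ(X) X - ρ(Y) Y`, applied to `f`. -/
lemma commutator (hρ : IsRealCoframe X Y Θ e₁ e₂ ρ V) (hy : y ∈ V) :
    fderiv ℝ (dirDeriv Y f) y (X y) - fderiv ℝ (dirDeriv X f) y (Y y)
      = -(2 * fderiv ℝ f y (T y) + ρ y (X y) * dirDeriv X f y + ρ y (Y y) * dirDeriv Y f y) := by
  have sX := hf.dirDeriv_smooth h.smooth_X h.isOpen
  have sY := hf.dirDeriv_smooth h.smooth_Y h.isOpen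
  have sT := hf.dirDeriv_smooth h.smooth_T h.isOpen
  have dX := sX.differentiableAt_of_mem h.isOpen hy
  have dY := sY.differentiableAt_of_mem h.isOpen hy
  have dT := sT.differentiableAt_of_mem h.isOpen hy
  have d0 := h.smooth_form.differentiableAt_of_mem h.isOpen hy
  have d1 := h.smooth₁.differentiableAt_of_mem h.isOpen hy
  have d2 := h.smooth₂.differentiableAt_of_mem h.isOpen hy
  obtain ⟨a, b, hab⟩ := hρ.structure_eq y hy
  have he : fderiv ℝ f =ᶠ[𝓝 y] fun z => dirDeriv T f z • Θ z + dirDeriv X f z • e₁ z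
      + dirDeriv Y f z • e₂ z := by
    filter_upwards [h.isOpen.mem_nhds hy] with z hz
    ext v
    rw [h.expand_form hz (fderiv ℝ f z) v]
    simp [dirDeriv]; ring
  have h0 := flatExtD_fderiv (hf.contDiffAt (h.isOpen.mem_nhds hy)) (X y) (Y y)
  rw [flatExtD_congr he, flatExtD_add ((dT.fun_smul d0).fun_add (dX.fun_smul d1)) (dY.fun_smul d2),
    flatExtD_add (dT.fun_smul d0) (dX.fun_smul d1), flatExtD_smul dT d0, flatExtD_smul dX d1,
    flatExtD_smul dY d2, (hab _ _).1, (hab _ _).2, h.levi y hy, h.form_X y hy, h.form_Y y hy,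
    h.e₁_X y hy, h.e₁_Y y hy, h.e₂_X y hy, h.e₂_Y y hy] at h0
  simp only [smul_eq_mul] at h0
  have : dirDeriv T f y = fderiv ℝ f y (T y) := rfl
  rw [← this]
  linear_combination h0

/-- The connection form of the coframe of `e^{2f} Θ`, and its exterior derivative. It is
`ρ + 3 (Xf e₂ - Yf e₁) + B Θ`, with the coefficients forced by the structure equations. -/
lemma conformal_connection (hρ : IsRealCoframe X Y Θ e₁ e₂ ρ V) :
    ∃ η : E → E →L[ℝ] ℝ, IsRealCoframe X Y (fun z => Real.exp (2 * f z) • Θ z)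
      (fun z => Real.exp (f z) • (e₁ z - dirDeriv Y f z • Θ z))
      (fun z => Real.exp (f z) • (e₂ z + dirDeriv X f z • Θ z)) η V ∧
      ∀ y ∈ V, flatExtD η y (X y) (Y y) = flatExtD ρ y (X y) (Y y)
        + 4 * (dirDeriv X (dirDeriv X f) y + dirDeriv Y (dirDeriv Y f) y)
        + 4 * (dirDeriv X f y ^ 2 + dirDeriv Y f y ^ 2)
        + 4 * (dirDeriv X f y * ρ y (Y y) - dirDeriv Y f y * ρ y (X y)) := by
  have hc := h.conformal hf
  have sX := hf.dirDeriv_smooth h.smooth_X h.isOpen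
  have sY := hf.dirDeriv_smooth h.smooth_Y h.isOpen
  have sXX := sX.dirDeriv_smooth h.smooth_X h.isOpen
  have sYY := sY.dirDeriv_smooth h.smooth_Y h.isOpen
  -- the coefficient of `Θ` in the connection form
  set B : E → ℝ := fun z => (1 / 2 : ℝ) * (dirDeriv X (dirDeriv X f) z + dirDeriv Y (dirDeriv Y f) z
    + 4 * (dirDeriv X f z * dirDeriv X f z + dirDeriv Y f z * dirDeriv Y f z)
    + (dirDeriv X f z * ρ z (Y z) - dirDeriv Y f z * ρ z (X z))) with hB
  have sB : ContDiffOn ℝ ∞ B V :=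
    contDiffOn_const.mul (((sXX.add sYY).add
      (contDiffOn_const.mul ((sX.mul sX).add (sY.mul sY)))).add
      ((sX.mul (hρ.smooth_conn.clm_apply h.smooth_Y)).sub
        (sY.mul (hρ.smooth_conn.clm_apply h.smooth_X))))
  have s3X : ContDiffOn ℝ ∞ (fun z => 3 * dirDeriv X f z) V := contDiffOn_const.mul sX
  have s3Y : ContDiffOn ℝ ∞ (fun z => 3 * dirDeriv Y f z) V := contDiffOn_const.mul sY
  refine ⟨fun z => ρ z + ((3 * dirDeriv X f z) • e₂ z - (3 * dirDeriv Y f z) • e₁ z) + B z • Θ z,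
    ⟨hc.smooth₁, hc.smooth₂, (hρ.smooth_conn.add ((s3X.smul h.smooth₂).sub
      (s3Y.smul h.smooth₁))).add (sB.smul h.smooth_form), ?_, ?_, hc.levi, ?_⟩, ?_⟩
  · intro z hz
    simp [h.form_X z hz, h.form_Y z hz, h.e₁_Y z hz, h.e₂_X z hz]
  · intro z hz
    simp [h.form_X z hz, h.form_Y z hz, h.e₁_X z hz, h.e₂_Y z hz]
  all_goals
    intro z hz
    have dX := sX.differentiableAt_of_mem h.isOpen hz
    have dY := sY.differentiableAt_of_mem h.isOpen hz
    have d0 := h.smooth_form.differentiableAt_of_mem h.isOpen hz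
    have d1 := h.smooth₁.differentiableAt_of_mem h.isOpen hz
    have d2 := h.smooth₂.differentiableAt_of_mem h.isOpen hz
    have dB := sB.differentiableAt_of_mem h.isOpen hz
    obtain ⟨a, b, hab⟩ := hρ.structure_eq z hz
  · have hcom := h.commutator hf hρ hz
    have hB' : 2 * B z = dirDeriv X (dirDeriv X f) z + dirDeriv Y (dirDeriv Y f) z
        + 4 * (dirDeriv X f z * dirDeriv X f z + dirDeriv Y f z * dirDeriv Y f z)
        + (dirDeriv X f z * ρ z (Y z) - dirDeriv Y f z * ρ z (X z)) := by simp only [hB]; ring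
    clear_value B
    have dE : HasFDerivAt (fun z => Real.exp (f z)) (Real.exp (f z) • fderiv ℝ f z) z :=
      (hf.differentiableAt_of_mem h.isOpen hz).hasFDerivAt.exp
    have hE2 : Real.exp (2 * f z) = Real.exp (f z) * Real.exp (f z) := by
      rw [← Real.exp_add]; congr 1; ring
    have hE0 := Real.exp_ne_zero (f z)
    -- the torsion `a' + i b'` of the new coframe
    obtain ⟨a', ha'⟩ : ∃ a' : ℝ, a' * (Real.exp (f z) * Real.exp (f z)) = fderiv ℝ f z (T z) + a
        + fderiv ℝ (dirDeriv Y f) z (X z) + dirDeriv X f z * ρ z (X z)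
        - 2 * dirDeriv X f z * dirDeriv Y f z :=
      ⟨_ / (Real.exp (f z) * Real.exp (f z)), div_mul_cancel₀ _ (mul_ne_zero hE0 hE0)⟩
    obtain ⟨b', hb'⟩ : ∃ b' : ℝ, b' * (Real.exp (f z) * Real.exp (f z)) = dirDeriv Y f z ^ 2 + b
        + fderiv ℝ (dirDeriv Y f) z (Y z) + dirDeriv X f z * ρ z (Y z)
        + 3 * dirDeriv X f z ^ 2 - B z :=
      ⟨_ / (Real.exp (f z) * Real.exp (f z)), div_mul_cancel₀ _ (mul_ne_zero hE0 hE0)⟩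
    have eXX : dirDeriv X (dirDeriv X f) z = fderiv ℝ (dirDeriv X f) z (X z) := rfl
    have eYY : dirDeriv Y (dirDeriv Y f) z = fderiv ℝ (dirDeriv Y f) z (Y z) := rfl
    refine ⟨a', b', fun u v => ⟨?_, ?_⟩⟩
    · rw [flatExtD_smul dE.differentiableAt (d1.fun_sub (dY.fun_smul d0)),
        flatExtD_sub d1 (dY.fun_smul d0), flatExtD_smul dY d0, h.levi z hz, (hab u v).1, dE.fderiv,
        hE2]
      simp only [smul_apply, sub_apply, add_apply, smul_eq_mul]
      rw [h.expand_form hz (fderiv ℝ f z) u, h.expand_form hz (fderiv ℝ f z) v,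
        h.expand_form hz (fderiv ℝ (dirDeriv Y f) z) u,
        h.expand_form hz (fderiv ℝ (dirDeriv Y f) z) v,
        h.expand_form hz (ρ z) u, h.expand_form hz (ρ z) v]
      have eX : fderiv ℝ f z (X z) = dirDeriv X f z := rfl
      have eY : fderiv ℝ f z (Y z) = dirDeriv Y f z := rfl
      simp only [smul_eq_mul, eX, eY]
      linear_combination
        (-Real.exp (f z) * (Θ z u * e₁ z v - Θ z v * e₁ z u)) * ha'
        + (-Real.exp (f z) * (Θ z u * e₂ z v - Θ z v * e₂ z u)) * hb'
    · rw [flatExtD_smul dE.differentiableAt (d2.fun_add (dX.fun_smul d0)),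
        flatExtD_add d2 (dX.fun_smul d0), flatExtD_smul dX d0, h.levi z hz, (hab u v).2, dE.fderiv,
        hE2]
      simp only [smul_apply, sub_apply, add_apply, smul_eq_mul]
      rw [h.expand_form hz (fderiv ℝ f z) u, h.expand_form hz (fderiv ℝ f z) v,
        h.expand_form hz (fderiv ℝ (dirDeriv X f) z) u,
        h.expand_form hz (fderiv ℝ (dirDeriv X f) z) v,
        h.expand_form hz (ρ z) u, h.expand_form hz (ρ z) v]
      have eX : fderiv ℝ f z (X z) = dirDeriv X f z := rfl
      have eY : fderiv ℝ f z (Y z) = dirDeriv Y f z := rfl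
      simp only [smul_eq_mul, eX, eY]
      linear_combination
        (-Real.exp (f z) * (Θ z u * e₁ z v - Θ z v * e₁ z u)) * (hb' - hB' - eXX - eYY)
        + (Real.exp (f z) * (Θ z u * e₂ z v - Θ z v * e₂ z u)) * (ha' + hcom)
  · have dρ := hρ.smooth_conn.differentiableAt_of_mem h.isOpen hz
    have d3X := s3X.differentiableAt_of_mem h.isOpen hz
    have d3Y := s3Y.differentiableAt_of_mem h.isOpen hz
    have dΘ : DifferentiableAt ℝ (fun z => (3 * dirDeriv X f z) • e₂ z
      - (3 * dirDeriv Y f z) • e₁ z) z := (d3X.fun_smul d2).fun_sub (d3Y.fun_smul d1)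
    rw [flatExtD_add (dρ.fun_add dΘ) (dB.fun_smul d0), flatExtD_add dρ dΘ,
      flatExtD_sub (d3X.fun_smul d2) (d3Y.fun_smul d1),
      flatExtD_smul d3X d2, flatExtD_smul d3Y d1, flatExtD_smul dB d0, fderiv_const_mul dX,
      fderiv_const_mul dY, (hab _ _).1, (hab _ _).2, h.levi z hz, h.form_X z hz, h.form_Y z hz,
      h.e₁_X z hz, h.e₁_Y z hz, h.e₂_X z hz, h.e₂_Y z hz]
    have eXX : dirDeriv X (dirDeriv X f) z = fderiv ℝ (dirDeriv X f) z (X z) := rfl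
    have eYY : dirDeriv Y (dirDeriv Y f) z = fderiv ℝ (dirDeriv Y f) z (Y z) := rfl
    simp only [smul_apply, smul_eq_mul, hB, ← eXX, ← eYY]
    ring

/-- The conformal transformation law of the Tanaka-Webster curvature. -/
lemma isFlatTanakaWebsterAt_conformal_iff (hρ : IsRealCoframe X Y Θ e₁ e₂ ρ V) (hy : y ∈ V)
    (w : ℝ) :
    IsFlatTanakaWebsterAt X Y (fun z => Real.exp (2 * f z) • Θ z) y w ↔
      w = Real.exp (-2 * f y) * (-(1 / 2) * flatExtD ρ y (X y) (Y y)
        - 2 * (dirDeriv X (dirDeriv X f) y + dirDeriv Y (dirDeriv Y f) y)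
        - 2 * (dirDeriv X f y ^ 2 + dirDeriv Y f y ^ 2)
        - 2 * (dirDeriv X f y * ρ y (Y y) - dirDeriv Y f y * ρ y (X y))) := by
  have hc := h.conformal hf
  obtain ⟨η, hη, hdη⟩ := h.conformal_connection hf hρ
  have hE2 : Real.exp (2 * f y) = Real.exp (f y) * Real.exp (f y) := by
    rw [← Real.exp_add]; congr 1; ring
  have hE : Real.exp (2 * f y) * Real.exp (-2 * f y) = 1 := by
    rw [← Real.exp_add]; simp
  have hE3 : Real.exp (-2 * f y) = Real.exp (-f y) * Real.exp (-f y) := by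
    rw [← Real.exp_add]; congr 1; ring
  constructor
  · intro hw
    -- uniqueness is available for the frame of `conformal`, which is a multiple of `X, Y`
    have hη' : IsRealCoframe (fun z => Real.exp (-f z) • X z) (fun z => Real.exp (-f z) • Y z)
        (fun z => Real.exp (2 * f z) • Θ z)
        (fun z => Real.exp (f z) • (e₁ z - dirDeriv Y f z • Θ z))
        (fun z => Real.exp (f z) • (e₂ z + dirDeriv X f z • Θ z)) η V :=
      { smooth₁ := hη.smooth₁
        smooth₂ := hη.smooth₂
        smooth_conn := hη.smooth_conn
        type₁ := fun z hz => by rw [map_smul, map_smul, hη.type₁ z hz, smul_neg]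
        type₂ := fun z hz => by rw [map_smul, map_smul, hη.type₂ z hz]
        levi := hη.levi
        structure_eq := hη.structure_eq }
    have := hc.isFlatTanakaWebsterAt_unique hη' hy (hw.smul_frame _)
    rw [flatExtD_smul_left, flatExtD_smul_right, hdη y hy, smul_eq_mul, smul_eq_mul, ← mul_assoc,
      ← hE3] at this
    linear_combination (1 / 2 : ℝ) * this
  · intro hw
    refine ⟨V, h.isOpen, hy, _, _, η, hη, ?_⟩
    rw [hdη y hy]
    simp only [smul_apply, sub_apply, add_apply, smul_eq_mul, h.form_X y hy, h.form_Y y hy,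
      h.e₁_X y hy, h.e₁_Y y hy, h.e₂_X y hy, h.e₂_Y y hy]
    have hE4 : Real.exp (f y) * Real.exp (f y) * Real.exp (-2 * f y) = 1 := by rw [← hE2, hE]
    rw [hw]
    linear_combination (2 * (-(1 / 2) * flatExtD ρ y (X y) (Y y)
        - 2 * (dirDeriv X (dirDeriv X f) y + dirDeriv Y (dirDeriv Y f) y)
        - 2 * (dirDeriv X f y ^ 2 + dirDeriv Y f y ^ 2)
        - 2 * (dirDeriv X f y * ρ y (Y y) - dirDeriv Y f y * ρ y (X y)))) * hE4

end IsReebFrame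

end Conformal

/-! ### Smoothness and exterior derivatives in charts -/

section Charts

variable {M : Type*} [TopologicalSpace M] [ChartedSpace E3 M] [IsManifold (𝓡 3) ∞ M]
variable {F : Type*} [NormedAddCommGroup F] [NormedSpace ℝ F]

/-- The derivative at `x` of the chart around `x₀`. -/
noncomputable def chartD (x₀ x : M) : TangentSpace (𝓡 3) x →L[ℝ] E3 :=
  mfderiv (𝓡 3) 𝓘(ℝ, E3) (extChartAt (𝓡 3) x₀) x

/-- The derivative at `y` of the inverse of the chart around `x₀`. -/
noncomputable def chartDSymm (x₀ : M) (y : E3) :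
    E3 →L[ℝ] TangentSpace (𝓡 3) ((extChartAt (𝓡 3) x₀).symm y) :=
  mfderiv 𝓘(ℝ, E3) (𝓡 3) (extChartAt (𝓡 3) x₀).symm y

instance : IsManifold (𝓡 3) 1 M := IsManifold.of_le (n := ∞) (by simp)

lemma chartD_chartDSymm {x₀ : M} {y : E3} (hy : y ∈ (extChartAt (𝓡 3) x₀).target) (v : E3) :
    chartD x₀ _ (chartDSymm x₀ y v) = v := by
  have h := mfderiv_extChartAt_comp_mfderivWithin_extChartAt_symm (I := 𝓡 3) hy
  rw [ModelWithCorners.range_eq_univ, mfderivWithin_univ] at h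
  exact DFunLike.congr_fun h v

lemma chartDSymm_chartD {x₀ : M} {y : E3} (hy : y ∈ (extChartAt (𝓡 3) x₀).target)
    (v : TangentSpace (𝓡 3) ((extChartAt (𝓡 3) x₀).symm y)) :
    chartDSymm x₀ y (chartD x₀ _ v) = v := by
  have h := mfderivWithin_extChartAt_symm_comp_mfderiv_extChartAt (I := 𝓡 3) hy
  rw [ModelWithCorners.range_eq_univ, mfderivWithin_univ] at h
  exact DFunLike.congr_fun h v

omit [IsManifold (𝓡 3) ∞ M] in
lemma formInChart_apply (α : ∀ x : M, TangentSpace (𝓡 3) x →L[ℝ] F) (x₀ : M) (y v : E3) :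
    formInChart α x₀ y v = α _ (chartDSymm x₀ y v) := rfl

omit [IsManifold (𝓡 3) ∞ M] in
lemma isOpen_chartSet {x₀ : M} {U : Set M} (hU : IsOpen U) :
    IsOpen ((extChartAt (𝓡 3) x₀).target ∩ (extChartAt (𝓡 3) x₀).symm ⁻¹' U) :=
  (continuousOn_extChartAt_symm x₀).isOpen_inter_preimage (isOpen_extChartAt_target x₀) hU

lemma contMDiffOn_iff_chart {x₀ : M} {U : Set M} (hUs : U ⊆ (extChartAt (𝓡 3) x₀).source)
    (g : M → F) :
    ContMDiffOn (𝓡 3) 𝓘(ℝ, F) ∞ g U ↔ ContDiffOn ℝ ∞ (fun y => g ((extChartAt (𝓡 3) x₀).symm y))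
      ((extChartAt (𝓡 3) x₀).target ∩ (extChartAt (𝓡 3) x₀).symm ⁻¹' U) := by
  rw [← contMDiffOn_iff_contDiffOn]
  constructor
  · intro h
    exact h.comp ((contMDiffOn_extChartAt_symm x₀).mono inter_subset_left) inter_subset_right
  · intro h
    have h1 : ContMDiffOn (𝓡 3) 𝓘(ℝ, E3) ∞ (extChartAt (𝓡 3) x₀) U :=
      contMDiffOn_extChartAt.mono (by rwa [extChartAt_source] at hUs)
    refine (h.comp h1 ?_).congr ?_
    · intro x hx
      refine ⟨(extChartAt (𝓡 3) x₀).map_source (hUs hx), ?_⟩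
      rw [mem_preimage, (extChartAt (𝓡 3) x₀).left_inv (hUs hx)]
      exact hx
    · intro x hx
      exact congrArg g ((extChartAt (𝓡 3) x₀).left_inv (hUs hx)).symm

lemma smoothVecFieldOn_iff_chart {x₀ : M} {U : Set M} (hU : IsOpen U)
    (hUs : U ⊆ (extChartAt (𝓡 3) x₀).source) (X : VecField M) :
    SmoothVecFieldOn X U ↔
      ContDiffOn ℝ ∞ (fun y => chartD x₀ _ (X ((extChartAt (𝓡 3) x₀).symm y)))
        ((extChartAt (𝓡 3) x₀).target ∩ (extChartAt (𝓡 3) x₀).symm ⁻¹' U) := by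
  have hUs' : U ⊆ (chartAt E3 x₀).source := by rwa [extChartAt_source] at hUs
  have hb : U ⊆ (trivializationAt E3 (TangentSpace (𝓡 3) : M → Type _) x₀).baseSet := hUs'
  rw [SmoothVecFieldOn, Bundle.Trivialization.contMDiffOn_section_iff
    (trivializationAt E3 (TangentSpace (𝓡 3) : M → Type _) x₀) hU hb,
    ← contMDiffOn_iff_chart hUs (fun x => chartD x₀ x (X x))]
  refine contMDiffOn_congr fun x hx => ?_
  have h := TangentBundle.continuousLinearMapAt_trivializationAt (I := 𝓡 3) (hUs' hx)
  rw [chartD, ← h]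
  exact (Bundle.Trivialization.continuousLinearMapAt_apply_of_mem ℝ
    (trivializationAt E3 (TangentSpace (𝓡 3) : M → Type _) x₀) (hb hx) (X x)).symm

lemma smoothOneFormOn_iff_chart {x₀ : M} {U : Set M} (hU : IsOpen U)
    (hUs : U ⊆ (extChartAt (𝓡 3) x₀).source) (α : ∀ x : M, TangentSpace (𝓡 3) x →L[ℝ] F) :
    SmoothOneFormOn α U ↔ ContDiffOn ℝ ∞ (formInChart α x₀)
        ((extChartAt (𝓡 3) x₀).target ∩ (extChartAt (𝓡 3) x₀).symm ⁻¹' U) := by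
  have hUs' : U ⊆ (chartAt E3 x₀).source := by rwa [extChartAt_source] at hUs
  let e := trivializationAt (E3 →L[ℝ] F)
    (fun x : M => TangentSpace (𝓡 3) x →L[ℝ] Bundle.Trivial M F x) x₀
  have hb : U ⊆ e.baseSet := by
    rw [hom_trivializationAt_baseSet]
    exact fun x hx => ⟨hUs' hx, mem_univ _⟩
  rw [SmoothOneFormOn, Bundle.Trivialization.contMDiffOn_section_iff e hU hb]
  have h1 : ∀ x ∈ U, (e ⟨x, α x⟩).2 = formInChart α x₀ (extChartAt (𝓡 3) x₀ x) := by
    intro x hx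
    simp only [e]
    rw [hom_trivializationAt_apply]
    ext v
    have h := TangentBundle.symmL_trivializationAt (I := 𝓡 3) (hUs' hx)
    rw [ModelWithCorners.range_eq_univ, mfderivWithin_univ] at h
    have key : ∀ x' : M, x' = x → ∀ w : E3, α x' w = α x w := by
      rintro x' rfl w; rfl
    refine Eq.trans ?_ (key _ ((extChartAt (𝓡 3) x₀).left_inv (hUs hx)) _).symm
    have h2 : (trivializationAt F (Bundle.Trivial M F) x₀).continuousLinearMapAt ℝ x
        = ContinuousLinearMap.id ℝ F := Bundle.Trivial.continuousLinearMapAt_trivialization ℝ M F x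
    rw [ContinuousLinearMap.inCoordinates, h2]
    exact congrArg (α x) (DFunLike.congr_fun h v)
  rw [contMDiffOn_congr h1, contMDiffOn_iff_chart hUs]
  refine contDiffOn_congr fun y hy => ?_
  exact congrArg _ ((extChartAt (𝓡 3) x₀).right_inv hy.1)

/-- Exterior derivatives commute with pullbacks. -/
lemma flatExtD_pullback {E : Type*} [NormedAddCommGroup E] [NormedSpace ℝ E]
    {β : E → E →L[ℝ] F} {τ : E → E} {z : E} (hτ : ContDiffAt ℝ ∞ τ z)
    (hβ : DifferentiableAt ℝ β (τ z)) (u v : E) :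
    flatExtD (fun z => (β (τ z)).comp (fderiv ℝ τ z)) z u v
      = flatExtD β (τ z) (fderiv ℝ τ z u) (fderiv ℝ τ z v) := by
  have h : IsSymmSndFDerivAt ℝ τ z := hτ.isSymmSndFDerivAt (by simpa using two_le_infty)
  have h1 : HasFDerivAt τ (fderiv ℝ τ z) z := (hτ.differentiableAt (by simp)).hasFDerivAt
  have h2 : HasFDerivAt (fderiv ℝ τ) (fderiv ℝ (fderiv ℝ τ) z) z :=
    ((hτ.fderiv_right (m := ∞) (by simp)).differentiableAt (by simp)).hasFDerivAt
  have h3 := (hβ.hasFDerivAt.comp z h1).clm_comp h2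
  simp only [Function.comp_def] at h3
  simp only [flatExtD, h3.fderiv]
  simp [h.eq u v]

omit [IsManifold (𝓡 3) ∞ M] in
/-- Transport along an equality of base points: every tangent space of `M` is `E3` by definition. -/
lemma apply_eq_of_base_eq (α : ∀ x : M, TangentSpace (𝓡 3) x →L[ℝ] F) {x x' : M} (h : x = x')
    (w : E3) : α x w = α x' w := by
  subst h; rfl

/-- The exterior derivative on `M` can be computed in the chart around any point `x₀`. -/
lemma extD_chartDSymm {α : ∀ x : M, TangentSpace (𝓡 3) x →L[ℝ] F} {x₀ : M} {y : E3}
    (hy : y ∈ (extChartAt (𝓡 3) x₀).target) (hα : DifferentiableAt ℝ (formInChart α x₀) y)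
    (u v : E3) :
    extD α _ (chartDSymm x₀ y u) (chartDSymm x₀ y v) = flatExtD (formInChart α x₀) y u v := by
  set φ := extChartAt (𝓡 3) x₀ with hφ
  set x := φ.symm y with hx
  set ψ := extChartAt (𝓡 3) x with hψ
  -- `extD` at `x` is defined by the chart around `x`, and `τ` is the change of charts
  set τ : E3 → E3 := fun z => φ (ψ.symm z) with hτ
  have hxs : x ∈ φ.source := φ.map_target hy
  have hxψ : x ∈ ψ.source := mem_extChartAt_source x
  have hO : IsOpen (ψ.target ∩ ψ.symm ⁻¹' φ.source) :=
    isOpen_chartSet (isOpen_extChartAt_source x₀)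
  have hz0 : ψ x ∈ ψ.target ∩ ψ.symm ⁻¹' φ.source :=
    ⟨ψ.map_source hxψ, by rw [mem_preimage, ψ.left_inv hxψ]; exact hxs⟩
  have hτs : ContDiffOn ℝ ∞ τ (ψ.target ∩ ψ.symm ⁻¹' φ.source) := by
    refine (contMDiffOn_iff_chart (x₀ := x) (U := φ.source ∩ ψ.source) inter_subset_right φ).1 ?_
      |>.mono ?_
    · exact contMDiffOn_extChartAt.mono (by rw [hφ, extChartAt_source]; exact inter_subset_left)
    · exact fun z hz => ⟨hz.1, hz.2, ψ.map_target hz.1⟩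
  have hτx : τ (ψ x) = y := by
    simp only [hτ, ψ.left_inv hxψ]; exact φ.right_inv hy
  have hmd : ∀ z ∈ ψ.target, MDifferentiableAt 𝓘(ℝ, E3) (𝓡 3) ψ.symm z := by
    intro z hz
    have := mdifferentiableWithinAt_extChartAt_symm (I := 𝓡 3) hz
    rwa [ModelWithCorners.range_eq_univ, mdifferentiableWithinAt_univ] at this
  have hmdφ : ∀ z ∈ φ.target, MDifferentiableAt 𝓘(ℝ, E3) (𝓡 3) φ.symm z := by
    intro z hz
    have := mdifferentiableWithinAt_extChartAt_symm (I := 𝓡 3) hz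
    rwa [ModelWithCorners.range_eq_univ, mdifferentiableWithinAt_univ] at this
  have hτd : ∀ z ∈ ψ.target ∩ ψ.symm ⁻¹' φ.source, MDifferentiableAt 𝓘(ℝ, E3) 𝓘(ℝ, E3) τ z :=
    fun z hz => (hτs.differentiableAt_of_mem hO hz).mdifferentiableAt
  have he : formInChart α x =ᶠ[𝓝 (ψ x)]
      fun z => (formInChart α x₀ (τ z)).comp (fderiv ℝ τ z) := by
    filter_upwards [hO.mem_nhds hz0] with z hz
    have hb : φ.symm (τ z) = ψ.symm z := φ.left_inv hz.2
    have h1 : mfderiv 𝓘(ℝ, E3) (𝓡 3) (fun z => φ.symm (τ z)) z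
        = (mfderiv 𝓘(ℝ, E3) (𝓡 3) φ.symm (τ z)).comp (mfderiv 𝓘(ℝ, E3) 𝓘(ℝ, E3) τ z) :=
      mfderiv_comp z (hmdφ _ (φ.map_source hz.2)) (hτd z hz)
    have h2 : (fun z => φ.symm (τ z)) =ᶠ[𝓝 z] ψ.symm := by
      filter_upwards [hO.mem_nhds hz] with z' hz' using φ.left_inv hz'.2
    rw [mfderiv_eq_fderiv] at h1
    ext w
    have h3 : (mfderiv 𝓘(ℝ, E3) (𝓡 3) (fun z => φ.symm (τ z)) z w : E3)
        = mfderiv 𝓘(ℝ, E3) (𝓡 3) ψ.symm z w :=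
      congrArg (fun L : E3 →L[ℝ] E3 => L w) h2.mfderiv_eq
    have h4 := DFunLike.congr_fun h1 w
    refine (apply_eq_of_base_eq α hb.symm _).trans ?_
    exact congrArg (α (φ.symm (τ z))) (h3.symm.trans h4)
  -- the derivative of `τ` turns coordinates in the chart around `x` into those around `x₀`
  have hu : ∀ w, fderiv ℝ τ (ψ x) (chartD x x (chartDSymm x₀ y w)) = w := by
    intro w
    have h1 : mfderiv (𝓡 3) 𝓘(ℝ, E3) (fun x => τ (ψ x)) x
        = (mfderiv 𝓘(ℝ, E3) 𝓘(ℝ, E3) τ (ψ x)).comp (mfderiv (𝓡 3) 𝓘(ℝ, E3) ψ x) :=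
      mfderiv_comp x (hτd _ hz0) (mdifferentiableAt_extChartAt (mem_chart_source _ x))
    have h2 : (fun x => τ (ψ x)) =ᶠ[𝓝 x] φ := by
      filter_upwards [(isOpen_extChartAt_source (I := 𝓡 3) x).mem_nhds hxψ] with x' hx'
      exact congrArg φ (ψ.left_inv hx')
    rw [h2.mfderiv_eq, mfderiv_eq_fderiv] at h1
    refine Eq.trans ?_ (chartD_chartDSymm hy w)
    exact (DFunLike.congr_fun h1 (chartDSymm x₀ y w)).symm
  change flatExtD (formInChart α x) (ψ x) (chartD x x (chartDSymm x₀ y u))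
    (chartD x x (chartDSymm x₀ y v)) = _
  rw [flatExtD_congr he, flatExtD_pullback (hτs.contDiffAt (hO.mem_nhds hz0)) (by rwa [hτx]),
    hu, hu, hτx]

end Charts

/-! ### Frames adapted to the CR structure -/

section AdaptedFrames

variable {M : Type*} [TopologicalSpace M] [ChartedSpace E3 M] [IsManifold (𝓡 3) ∞ M]
variable {F : Type*} [NormedAddCommGroup F] [NormedSpace ℝ F]

/-- `X, Y` are the expressions, in the chart around `x₀`, of a smooth frame `Z, JZ` of the plane
field of `S`. -/
structure IsAdaptedFrame (S : CRStructure M) (x₀ : M) (X Y : E3 → E3) (V : Set E3) : Prop where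
  isOpen : IsOpen V
  subset : V ⊆ (extChartAt (𝓡 3) x₀).target
  smooth_X : ContDiffOn ℝ ∞ X V
  smooth_Y : ContDiffOn ℝ ∞ Y V
  J_X : ∀ y ∈ V, ∃ h : chartDSymm x₀ y (X y) ∈ S.ξ _,
    (S.J _ ⟨_, h⟩ : TangentSpace (𝓡 3) _) = chartDSymm x₀ y (Y y)
  span : ∀ y ∈ V, ∀ v, chartDSymm x₀ y v ∈ S.ξ _ → ∃ a b : ℝ, v = a • X y + b • Y y

lemma IsPosPseudohermitian.smooth_chart {S : CRStructure M} {θ : RealOneForm M}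
    (hθ : IsPosPseudohermitian S θ) (x₀ : M) :
    ContDiffOn ℝ ∞ (formInChart θ x₀) (extChartAt (𝓡 3) x₀).target := by
  have h : SmoothOneFormOn θ (extChartAt (𝓡 3) x₀).source := hθ.contact.1.mono (subset_univ _)
  refine ((smoothOneFormOn_iff_chart (isOpen_extChartAt_source x₀) subset_rfl θ).1 h).mono ?_
  exact fun y hy => ⟨hy, (extChartAt (𝓡 3) x₀).map_target hy⟩

lemma IsPosPseudohermitian.exists_ne_zero {S : CRStructure M} {θ : RealOneForm M}
    (hθ : IsPosPseudohermitian S θ) (x : M) : ∃ v, θ x v ≠ 0 := by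
  obtain ⟨u, v, w, h⟩ := hθ.contact.2 x (mem_univ x)
  by_contra! h0
  simp [h0] at h

/-- The 1-form on the domain of the chart around `x₀` given by `β` in that chart. (Off the domain, a
junk value.) -/
noncomputable def formOfChart (x₀ : M) (β : E3 → E3 →L[ℝ] F) (x : M) :
    TangentSpace (𝓡 3) x →L[ℝ] F :=
  (β (extChartAt (𝓡 3) x₀ x)).comp (chartD x₀ x)

lemma formInChart_formOfChart {x₀ : M} (β : E3 → E3 →L[ℝ] F) {y : E3}
    (hy : y ∈ (extChartAt (𝓡 3) x₀).target) : formInChart (formOfChart x₀ β) x₀ y = β y := by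
  ext v
  rw [formInChart_apply]
  simp only [formOfChart, ContinuousLinearMap.comp_apply]
  rw [chartD_chartDSymm hy, (extChartAt (𝓡 3) x₀).right_inv hy]

/-- The vector field on the domain of the chart around `x₀` given by `X` in that chart. (Off the
domain, a junk value.) -/
noncomputable def fieldOfChart (x₀ : M) (X : E3 → E3) (x : M) : TangentSpace (𝓡 3) x :=
  (chartD x₀ x).inverse (X (extChartAt (𝓡 3) x₀ x))

lemma fieldOfChart_symm {x₀ : M} (X : E3 → E3) {y : E3}
    (hy : y ∈ (extChartAt (𝓡 3) x₀).target) :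
    fieldOfChart x₀ X ((extChartAt (𝓡 3) x₀).symm y) = chartDSymm x₀ y (X y) := by
  have h : (chartD x₀ ((extChartAt (𝓡 3) x₀).symm y)).inverse = chartDSymm x₀ y :=
    ContinuousLinearMap.inverse_eq (by ext1 v; exact chartD_chartDSymm hy v)
      (by ext1 v; exact chartDSymm_chartD hy v)
  rw [fieldOfChart, h, (extChartAt (𝓡 3) x₀).right_inv hy]

/-- A smooth nowhere zero section `Z` of the plane field and the field `JZ`, in the chart around
`x₀`. -/
lemma exists_frame {S : CRStructure M} {θ : RealOneForm M} (hθ : IsPosPseudohermitian S θ)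
    (x₀ : M) : ∃ V : Set E3, IsOpen V ∧ V ⊆ (extChartAt (𝓡 3) x₀).target ∧
      extChartAt (𝓡 3) x₀ x₀ ∈ V ∧ ∃ X Y : E3 → E3, ContDiffOn ℝ ∞ X V ∧ ContDiffOn ℝ ∞ Y V ∧
      ∀ y ∈ V, X y ≠ 0 ∧ ∃ h : chartDSymm x₀ y (X y) ∈ S.ξ _,
        (S.J _ ⟨_, h⟩ : TangentSpace (𝓡 3) _) = chartDSymm x₀ y (Y y) := by
  classical
  set φ := extChartAt (𝓡 3) x₀ with hφ
  set Θ := formInChart θ x₀ with hΘ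
  have sΘ : ContDiffOn ℝ ∞ Θ φ.target := hθ.smooth_chart x₀
  have hy0 : φ x₀ ∈ φ.target := mem_extChartAt_target x₀
  obtain ⟨u, hu⟩ : ∃ u, Θ (φ x₀) u ≠ 0 := by
    obtain ⟨v, hv⟩ := hθ.exists_ne_zero (φ.symm (φ x₀))
    refine ⟨chartD x₀ _ v, ?_⟩
    rwa [hΘ, formInChart_apply, chartDSymm_chartD hy0]
  obtain ⟨e, he, he0⟩ : ∃ e, Θ (φ x₀) e = 0 ∧ e ≠ 0 := by
    have h := LinearMap.ker_ne_bot_of_finrank_lt (f := (Θ (φ x₀) : E3 →ₗ[ℝ] ℝ)) (by simp)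
    obtain ⟨e, he, he0⟩ := Submodule.exists_mem_ne_zero_of_ne_bot h
    exact ⟨e, he, he0⟩
  have su : ∀ v : E3, ContDiffOn ℝ ∞ (fun y => Θ y v) φ.target := fun v =>
    sΘ.clm_apply contDiffOn_const
  -- project the constant field `e` to `ker Θ` along `u`
  set X : E3 → E3 := fun y => e - (Θ y e / Θ y u) • u with hX
  set V : Set E3 := φ.target ∩ {y | Θ y u ≠ 0} with hV
  have hVo : IsOpen V :=
    (su u).continuousOn.isOpen_inter_preimage (isOpen_extChartAt_target x₀) isOpen_ne
  have hVt : V ⊆ φ.target := inter_subset_left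
  have sX : ContDiffOn ℝ ∞ X V := contDiffOn_const.sub
    ((((su e).mono hVt).div ((su u).mono hVt) (fun y hy => hy.2)).smul contDiffOn_const)
  have hΘX : ∀ y ∈ V, Θ y (X y) = 0 := by
    intro y hy
    have : Θ y u ≠ 0 := hy.2
    simp only [hX, map_sub, map_smul, smul_eq_mul]; field_simp; ring
  have hmem : ∀ y ∈ V, fieldOfChart x₀ X (φ.symm y) ∈ S.ξ (φ.symm y) := by
    intro y hy
    rw [fieldOfChart_symm X (hVt hy), hθ.ker]
    exact hΘX y hy
  -- `smooth_J` wants a section over all of `M`; extend by zero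
  set Z : ∀ x : M, S.ξ x := fun x =>
    if h : fieldOfChart x₀ X x ∈ S.ξ x then ⟨_, h⟩ else 0 with hZ
  have hZy : ∀ y ∈ V, (Z (φ.symm y) : TangentSpace (𝓡 3) (φ.symm y)) = chartDSymm x₀ y (X y) := by
    intro y hy
    simp only [hZ, dif_pos (hmem y hy)]
    exact fieldOfChart_symm X (hVt hy)
  set U : Set M := φ.source ∩ φ ⁻¹' V with hU
  have hUo : IsOpen U := isOpen_extChartAt_preimage' x₀ hVo
  have hUV : φ.target ∩ φ.symm ⁻¹' U = V := by
    ext y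
    constructor
    · rintro ⟨hy, hy'⟩
      have := hy'.2
      rwa [mem_preimage, φ.right_inv hy] at this
    · intro hy
      refine ⟨hVt hy, φ.map_target (hVt hy), ?_⟩
      rwa [mem_preimage, φ.right_inv (hVt hy)]
  have hUs : U ⊆ φ.source := inter_subset_left
  have sZ : SmoothVecFieldOn (fun x => (Z x : TangentSpace (𝓡 3) x)) U := by
    rw [smoothVecFieldOn_iff_chart hUo hUs, hUV]
    refine sX.congr fun y hy => ?_
    rw [hZy y hy, chartD_chartDSymm (hVt hy)]
  have sJZ := S.smooth_J U hUo Z sZ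
  rw [smoothVecFieldOn_iff_chart hUo hUs, hUV] at sJZ
  refine ⟨V, hVo, hVt, ⟨hy0, hu⟩, X, _, sX, sJZ, fun y hy => ⟨?_, ?_, ?_⟩⟩
  · intro h0
    have h1 : e = (Θ y e / Θ y u) • u := sub_eq_zero.1 h0
    rw [h1, map_smul, smul_eq_mul] at he
    rcases mul_eq_zero.1 he with h2 | h2
    · rw [h2, zero_smul] at h1; exact he0 h1
    · exact hu h2
  · rw [← hZy y hy]; exact (Z _).2
  · rw [chartDSymm_chartD (hVt hy)]
    congr 2
    exact Subtype.ext (hZy y hy).symm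

/-- A frame `X, Y` of `ker Θ` with `dΘ(X, Y) = 2` extends to a frame that contains the
characteristic vector field. -/
lemma exists_reebFrame {Θ : E3 → E3 →L[ℝ] ℝ} {X Y : E3 → E3} {V : Set E3} {y₀ : E3}
    (hV : IsOpen V) (hy₀ : y₀ ∈ V) (sΘ : ContDiffOn ℝ ∞ Θ V) (sX : ContDiffOn ℝ ∞ X V)
    (sY : ContDiffOn ℝ ∞ Y V) (hX : ∀ y ∈ V, Θ y (X y) = 0) (hY : ∀ y ∈ V, Θ y (Y y) = 0)
    (hXY : ∀ y ∈ V, flatExtD Θ y (X y) (Y y) = 2) {u : E3} (hu : Θ y₀ u ≠ 0) :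
    ∃ V' ⊆ V, y₀ ∈ V' ∧ ∃ (e₁ e₂ : E3 → E3 →L[ℝ] ℝ) (T : E3 → E3),
      IsReebFrame Θ e₁ e₂ T X Y V' := by
  set V' : Set E3 := V ∩ {y | Θ y u ≠ 0} with hV'
  have su : ContDiffOn ℝ ∞ (fun y => Θ y u) V := sΘ.clm_apply contDiffOn_const
  have hVo : IsOpen V' := su.continuousOn.isOpen_inter_preimage hV isOpen_ne
  have hs : V' ⊆ V := inter_subset_left
  set e₁ : E3 → E3 →L[ℝ] ℝ := fun y =>
    (1 / 2 : ℝ) • ((fderiv ℝ Θ y).flip (Y y) - fderiv ℝ Θ y (Y y)) with he₁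
  set e₂ : E3 → E3 →L[ℝ] ℝ := fun y =>
    (1 / 2 : ℝ) • (fderiv ℝ Θ y (X y) - (fderiv ℝ Θ y).flip (X y)) with he₂
  have he₁' : ∀ y v, e₁ y v = 1 / 2 * flatExtD Θ y v (Y y) := fun y v => by simp [he₁, flatExtD]
  have he₂' : ∀ y v, e₂ y v = 1 / 2 * flatExtD Θ y (X y) v := fun y v => by simp [he₂, flatExtD]
  have sflip : ContDiffOn ℝ ∞ (fun y => (fderiv ℝ Θ y).flip) V :=
    contDiffOn_clm_apply.2 fun v => contDiffOn_clm_apply.2 fun w =>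
      ((sΘ.fderiv_smooth hV).clm_apply contDiffOn_const).clm_apply contDiffOn_const
  have s1 : ContDiffOn ℝ ∞ e₁ V := (contDiffOn_const (c := (1 / 2 : ℝ))).smul
    ((sflip.clm_apply sY).sub ((sΘ.fderiv_smooth hV).clm_apply sY))
  have s2 : ContDiffOn ℝ ∞ e₂ V := (contDiffOn_const (c := (1 / 2 : ℝ))).smul
    (((sΘ.fderiv_smooth hV).clm_apply sX).sub (sflip.clm_apply sX))
  set T : E3 → E3 := fun y => (Θ y u)⁻¹ • (u - e₁ y u • X y - e₂ y u • Y y) with hT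
  have e1X : ∀ y ∈ V, e₁ y (X y) = 1 := fun y hy => by rw [he₁', hXY y hy]; norm_num
  have e1Y : ∀ y ∈ V, e₁ y (Y y) = 0 := fun y hy => by rw [he₁', flatExtD_self]; norm_num
  have e2X : ∀ y ∈ V, e₂ y (X y) = 0 := fun y hy => by rw [he₂', flatExtD_self]; norm_num
  have e2Y : ∀ y ∈ V, e₂ y (Y y) = 1 := fun y hy => by rw [he₂', hXY y hy]; norm_num
  have hTT : ∀ y ∈ V', Θ y (T y) = 1 := by
    intro y hy
    have : Θ y u ≠ 0 := hy.2
    simp [hT, hX y hy.1, hY y hy.1, this]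
  have e1T : ∀ y ∈ V', e₁ y (T y) = 0 := by
    intro y hy; simp [hT, e1X y hy.1, e1Y y hy.1]
  have e2T : ∀ y ∈ V', e₂ y (T y) = 0 := by
    intro y hy; simp [hT, e2X y hy.1, e2Y y hy.1]
  have hexp : ∀ y ∈ V', ∀ v, v = Θ y v • T y + e₁ y v • X y + e₂ y v • Y y := by
    intro y hy
    have hli : LinearIndependent ℝ ![T y, X y, Y y] := by
      rw [Fintype.linearIndependent_iff]
      intro g hg
      simp only [Fin.sum_univ_three, Matrix.cons_val_zero, Matrix.cons_val_one,
        Matrix.cons_val_two] at hg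
      have h0 := congrArg (Θ y) hg
      have h1 := congrArg (e₁ y) hg
      have h2 := congrArg (e₂ y) hg
      simp [hTT y hy, hX y hy.1, hY y hy.1] at h0
      simp [e1T y hy, e1X y hy.1, e1Y y hy.1] at h1
      simp [e2T y hy, e2X y hy.1, e2Y y hy.1] at h2
      intro i; fin_cases i <;> assumption
    have hsp := hli.span_eq_top_of_card_eq_finrank (by simp)
    intro v
    have hv : v ∈ Submodule.span ℝ (range ![T y, X y, Y y]) := hsp ▸ Submodule.mem_top
    rw [Submodule.mem_span_range_iff_exists_fun] at hv
    obtain ⟨c, rfl⟩ := hv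
    simp [Fin.sum_univ_three, hTT y hy, hX y hy.1, hY y hy.1, e1T y hy, e1X y hy.1, e1Y y hy.1,
      e2T y hy, e2X y hy.1, e2Y y hy.1]
  refine ⟨V', hs, ⟨hy₀, hu⟩, e₁, e₂, T, ⟨hVo, sΘ.mono hs, s1.mono hs, s2.mono hs, ?_, sX.mono hs,
    sY.mono hs, hexp, hTT, fun y hy => hX y hy.1, fun y hy => hY y hy.1, e1T,
    fun y hy => e1X y hy.1, fun y hy => e1Y y hy.1, e2T, fun y hy => e2X y hy.1,
    fun y hy => e2Y y hy.1, ?_⟩⟩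
  · have sc : ∀ {e : E3 → E3 →L[ℝ] ℝ}, ContDiffOn ℝ ∞ e V → ContDiffOn ℝ ∞ (fun y => e y u) V' :=
      fun he => (he.mono hs).clm_apply contDiffOn_const
    exact ((sc sΘ).inv fun y hy => hy.2).smul ((contDiffOn_const.sub
      ((sc s1).smul (sX.mono hs))).sub ((sc s2).smul (sY.mono hs)))
  · intro y hy u' v'
    have hTX : flatExtD Θ y (X y) (T y) = 0 := by linarith [he₂' y (T y), e2T y hy]
    have hTY : flatExtD Θ y (T y) (Y y) = 0 := by linarith [he₁' y (T y), e1T y hy]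
    conv_lhs => rw [hexp y hy u', hexp y hy v']
    simp only [flatExtD_add_left, flatExtD_add_right, flatExtD_smul_left, flatExtD_smul_right,
      flatExtD_self, flatExtD_swap Θ y (X y) (T y), flatExtD_swap Θ y (T y) (Y y),
      flatExtD_swap Θ y (X y) (Y y), smul_eq_mul, hTX, hTY, hXY y hy.1]
    ring

/-- Around every point, the plane field and its complex structure have a frame `Z, JZ` that is part
of a frame with dual coframe as in `IsReebFrame`. -/
lemma exists_adapted_reebFrame {S : CRStructure M} {θ : RealOneForm M}
    (hθ : IsPosPseudohermitian S θ) (x₀ : M) :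
    ∃ (V : Set E3) (X Y : E3 → E3) (e₁ e₂ : E3 → E3 →L[ℝ] ℝ) (T : E3 → E3),
      extChartAt (𝓡 3) x₀ x₀ ∈ V ∧ IsAdaptedFrame S x₀ X Y V ∧
      IsReebFrame (formInChart θ x₀) e₁ e₂ T X Y V := by
  obtain ⟨V, hVo, hVt, hy0, X, Y, sX, sY, hXY⟩ := exists_frame hθ x₀
  set φ := extChartAt (𝓡 3) x₀ with hφ
  set Θ := formInChart θ x₀ with hΘ
  have sΘ : ContDiffOn ℝ ∞ Θ V := (hθ.smooth_chart x₀).mono hVt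
  have hpos : ∀ y ∈ V, 0 < flatExtD Θ y (X y) (Y y) := by
    intro y hy
    obtain ⟨hX0, hm, hJ⟩ := hXY y hy
    rw [← extD_chartDSymm (hVt hy) (sΘ.differentiableAt_of_mem hVo hy), ← hJ]
    refine hθ.pos _ ⟨_, hm⟩ fun h0 => hX0 ?_
    have h1 : chartDSymm x₀ y (X y) = 0 := congrArg Subtype.val h0
    rw [← chartD_chartDSymm (hVt hy) (X y), h1, map_zero]
  have shh : ContDiffOn ℝ ∞ (fun y => flatExtD Θ y (X y) (Y y)) V := sΘ.flatExtD_smooth hVo sX sY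
  -- rescale the frame so that `dΘ(X, Y) = 2`, the normalization of `IsReebFrame`
  set g : E3 → ℝ := fun y => Real.sqrt (2 / flatExtD Θ y (X y) (Y y)) with hg
  have sg : ContDiffOn ℝ ∞ g V :=
    (contDiffOn_const.div shh fun y hy => (hpos y hy).ne').sqrt
      fun y hy => (div_pos two_pos (hpos y hy)).ne'
  have hg2 : ∀ y ∈ V, g y * g y * flatExtD Θ y (X y) (Y y) = 2 := by
    intro y hy
    have := hpos y hy
    simp only [hg]
    rw [Real.mul_self_sqrt (div_pos two_pos this).le]
    field_simp
  obtain ⟨u, hu⟩ : ∃ u, Θ (φ x₀) u ≠ 0 := by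
    obtain ⟨v, hv⟩ := hθ.exists_ne_zero (φ.symm (φ x₀))
    refine ⟨chartD x₀ _ v, ?_⟩
    rwa [hΘ, formInChart_apply, chartDSymm_chartD (hVt hy0)]
  have hΘX : ∀ y ∈ V, Θ y (X y) = 0 := fun y hy => (hθ.ker _ _).1 (hXY y hy).2.1
  have hΘY : ∀ y ∈ V, Θ y (Y y) = 0 := by
    intro y hy
    obtain ⟨hX0, hm, hJ⟩ := hXY y hy
    have hm' : chartDSymm x₀ y (Y y) ∈ S.ξ _ := by rw [← hJ]; exact Subtype.mem _
    exact (hθ.ker _ _).1 hm'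
  obtain ⟨V', hV', hy0', e₁, e₂, T, hR⟩ := exists_reebFrame (Θ := Θ) (X := fun y => g y • X y)
    (Y := fun y => g y • Y y) hVo hy0 sΘ (sg.smul sX) (sg.smul sY)
    (fun y hy => by rw [map_smul, hΘX y hy, smul_zero])
    (fun y hy => by rw [map_smul, hΘY y hy, smul_zero])
    (fun y hy => by
      rw [flatExtD_smul_left, flatExtD_smul_right, smul_eq_mul, smul_eq_mul, ← mul_assoc,
        hg2 y hy]) hu
  refine ⟨V', _, _, e₁, e₂, T, hy0', ⟨hR.isOpen, hV'.trans hVt, hR.smooth_X, hR.smooth_Y, ?_, ?_⟩,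
    hR⟩
  · intro y hy
    obtain ⟨hX0, hm, hJ⟩ := hXY y (hV' hy)
    have h1 : chartDSymm x₀ y (g y • X y) = g y • chartDSymm x₀ y (X y) := map_smul _ _ _
    refine ⟨h1 ▸ Submodule.smul_mem _ _ hm, ?_⟩
    have h2 : (⟨chartDSymm x₀ y (g y • X y), h1 ▸ Submodule.smul_mem _ _ hm⟩ : S.ξ _)
        = g y • ⟨_, hm⟩ := Subtype.ext h1
    rw [h2, map_smul, map_smul, ← hJ]; rfl
  · intro y hy v hv
    have h0 : Θ y v = 0 := (hθ.ker _ _).1 hv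
    refine ⟨e₁ y v, e₂ y v, ?_⟩
    have := hR.expand y hy v
    rwa [h0, zero_smul, zero_add] at this

end AdaptedFrames

/-! ### The Tanaka-Webster curvature on the manifold and in charts -/

section Bridge

variable {M : Type*} [TopologicalSpace M] [ChartedSpace E3 M] [IsManifold (𝓡 3) ∞ M]
variable {S : CRStructure M} {θ : RealOneForm M} {x₀ : M} {X Y : E3 → E3} {V : Set E3} {y : E3}

omit [IsManifold (𝓡 3) ∞ M] in
lemma wedge_apply {x : M} (α β : TangentSpace (𝓡 3) x →L[ℝ] ℂ) (u v : TangentSpace (𝓡 3) x) :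
    wedge α β u v = α u * β v - α v * β u := rfl

omit [IsManifold (𝓡 3) ∞ M] in
lemma conjForm_apply {x : M} (α : TangentSpace (𝓡 3) x →L[ℝ] ℂ) (u : TangentSpace (𝓡 3) x) :
    conjForm α u = (starRingEnd ℂ) (α u) := rfl

omit [IsManifold (𝓡 3) ∞ M] in
lemma toComplexForm_apply {x : M} (α : TangentSpace (𝓡 3) x →L[ℝ] ℝ) (u : TangentSpace (𝓡 3) x) :
    toComplexForm α u = (α u : ℂ) := rfl

/-- A Tanaka-Webster curvature on `M` gives one in the chart, by taking real and imaginary parts of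
the unitary coframe. -/
lemma IsTanakaWebsterAt.flat (hθ : IsPosPseudohermitian S θ) (hF : IsAdaptedFrame S x₀ X Y V)
    (hy : y ∈ V) {w : ℝ} (hw : IsTanakaWebsterAt S θ ((extChartAt (𝓡 3) x₀).symm y) w) :
    IsFlatTanakaWebsterAt X Y (formInChart θ x₀) y w := by
  obtain ⟨U, hU, hxU, θ1, om, hθ1, hom, hdom⟩ := hw
  set φ := extChartAt (𝓡 3) x₀ with hφ
  have hUo : IsOpen (φ.source ∩ U) := (isOpen_extChartAt_source x₀).inter hU
  have hUs : φ.source ∩ U ⊆ φ.source := inter_subset_left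
  have s1 := (smoothOneFormOn_iff_chart hUo hUs θ1).1 (hθ1.smooth.mono inter_subset_right)
  have so := (smoothOneFormOn_iff_chart hUo hUs om).1 (hom.smooth.mono inter_subset_right)
  set V' : Set E3 := V ∩ (φ.target ∩ φ.symm ⁻¹' (φ.source ∩ U)) with hV'
  have hVo : IsOpen V' := hF.isOpen.inter (isOpen_chartSet hUo)
  have hVt : ∀ z ∈ V', z ∈ φ.target := fun z hz => hz.2.1
  have hVU : ∀ z ∈ V', φ.symm z ∈ U := fun z hz => hz.2.2.2
  replace s1 := s1.mono (inter_subset_right : V' ⊆ _)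
  replace so := so.mono (inter_subset_right : V' ⊆ _)
  have sΘ : ContDiffOn ℝ ∞ (formInChart θ x₀) V' := (hθ.smooth_chart x₀).mono hVt
  have hyV : y ∈ V' := ⟨hy, hF.subset hy, φ.map_target (hF.subset hy), hxU⟩
  have d1 : ∀ z ∈ V', DifferentiableAt ℝ (formInChart θ1 x₀) z :=
    fun z hz => s1.differentiableAt_of_mem hVo hz
  have dO : ∀ z ∈ V', DifferentiableAt ℝ (formInChart om x₀) z :=
    fun z hz => so.differentiableAt_of_mem hVo hz
  have dΘ : ∀ z ∈ V', DifferentiableAt ℝ (formInChart θ x₀) z :=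
    fun z hz => sΘ.differentiableAt_of_mem hVo hz
  have hre : ∀ z ∈ V', ∀ v, (formInChart om x₀ z v).re = 0 := by
    intro z hz v
    have h := DFunLike.congr_fun (hom.skew _ (hVU z hz)) (chartDSymm x₀ z v)
    have h' : formInChart om x₀ z v + (starRingEnd ℂ) (formInChart om x₀ z v) = 0 := h
    have := congrArg Complex.re h'
    simp at this
    linarith
  have htype : ∀ z ∈ V', formInChart θ1 x₀ z (Y z) = Complex.I * formInChart θ1 x₀ z (X z) := by
    intro z hz
    obtain ⟨hm, hJ⟩ := hF.J_X z hz.1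
    have := hθ1.type _ (hVU z hz) ⟨_, hm⟩
    rw [hJ] at this
    exact this
  refine ⟨V', hVo, hyV, fun z => Complex.reCLM.comp (formInChart θ1 x₀ z),
    fun z => Complex.imCLM.comp (formInChart θ1 x₀ z),
    fun z => Complex.imCLM.comp (formInChart om x₀ z), ⟨contDiffOn_const.clm_comp s1,
    contDiffOn_const.clm_comp s1, contDiffOn_const.clm_comp so, ?_, ?_, ?_, ?_⟩, ?_⟩
  · intro z hz; simp [htype z hz]
  · intro z hz; simp [htype z hz]
  · intro z hz u v
    have h := hθ1.levi _ (hVU z hz) (chartDSymm x₀ z u) (chartDSymm x₀ z v)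
    rw [extD_chartDSymm (hVt z hz) (dΘ z hz), wedge_apply, conjForm_apply, conjForm_apply] at h
    rw [← formInChart_apply, ← formInChart_apply] at h
    have := congrArg Complex.re h
    simp at this
    simp only [ContinuousLinearMap.comp_apply, Complex.reCLM_apply, Complex.imCLM_apply]
    linarith
  · obtain ⟨A, hA⟩ := hom.structure_eq
    intro z hz
    refine ⟨(A (φ.symm z)).re, (A (φ.symm z)).im, fun u v => ?_⟩
    have h := hA _ (hVU z hz) (chartDSymm x₀ z u) (chartDSymm x₀ z v)
    rw [extD_chartDSymm (hVt z hz) (d1 z hz), wedge_apply, wedge_apply, conjForm_apply,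
      conjForm_apply, toComplexForm_apply, toComplexForm_apply] at h
    rw [← formInChart_apply, ← formInChart_apply, ← formInChart_apply, ← formInChart_apply,
      ← formInChart_apply, ← formInChart_apply] at h
    rw [flatExtD_clm_comp _ (d1 z hz), flatExtD_clm_comp _ (d1 z hz), h]
    simp [hre z hz]
    constructor <;> ring
  · obtain ⟨hm, hJ⟩ := hF.J_X y hy
    have h := hdom _ hm _ (Subtype.mem (S.J _ ⟨_, hm⟩))
    rw [hJ, extD_chartDSymm (hVt y hyV) (dO y hyV), wedge_apply, conjForm_apply,
      conjForm_apply] at h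
    rw [← formInChart_apply, ← formInChart_apply] at h
    rw [flatExtD_clm_comp _ (dO y hyV), h]
    simp
    ring

/-- A Tanaka-Webster curvature in the chart gives one on `M`. -/
lemma IsFlatTanakaWebsterAt.lift (hθ : IsPosPseudohermitian S θ) (hF : IsAdaptedFrame S x₀ X Y V)
    (hy : y ∈ V) {w : ℝ} (hw : IsFlatTanakaWebsterAt X Y (formInChart θ x₀) y w) :
    IsTanakaWebsterAt S θ ((extChartAt (𝓡 3) x₀).symm y) w := by
  obtain ⟨V₁, hV₁, hyV₁, α₁, α₂, ρ, hα, hρ⟩ := hw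
  set φ := extChartAt (𝓡 3) x₀ with hφ
  set V' : Set E3 := V ∩ V₁ with hV'
  have hVo : IsOpen V' := hF.isOpen.inter hV₁
  have hVt : ∀ z ∈ V', z ∈ φ.target := fun z hz => hF.subset hz.1
  have hyV : y ∈ V' := ⟨hy, hyV₁⟩
  replace hα := hα.mono (inter_subset_right : V' ⊆ V₁)
  set U : Set M := φ.source ∩ φ ⁻¹' V' with hU
  have hUo : IsOpen U := isOpen_extChartAt_preimage' x₀ hVo
  have hUs : U ⊆ φ.source := inter_subset_left
  have hUV : φ.target ∩ φ.symm ⁻¹' U = V' := by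
    ext y
    constructor
    · rintro ⟨hy, hy'⟩
      have := hy'.2
      rwa [mem_preimage, φ.right_inv hy] at this
    · intro hy
      refine ⟨hVt y hy, φ.map_target (hVt y hy), ?_⟩
      rwa [mem_preimage, φ.right_inv (hVt y hy)]
  have hUV' : ∀ x ∈ U, ∃ z ∈ V', φ.symm z = x := fun x hx => ⟨φ x, hx.2, φ.left_inv hx.1⟩
  set β : E3 → E3 →L[ℝ] ℂ := fun z => Complex.ofRealCLM.comp (α₁ z)
    + (Complex.I • Complex.ofRealCLM).comp (α₂ z) with hβ
  set o : E3 → E3 →L[ℝ] ℂ := fun z => (Complex.I • Complex.ofRealCLM).comp (ρ z) with ho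
  have sβ : ContDiffOn ℝ ∞ β V' :=
    (contDiffOn_const.clm_comp hα.smooth₁).add (contDiffOn_const.clm_comp hα.smooth₂)
  have so : ContDiffOn ℝ ∞ o V' := contDiffOn_const.clm_comp hα.smooth_conn
  have sΘ : ContDiffOn ℝ ∞ (formInChart θ x₀) V' := (hθ.smooth_chart x₀).mono hVt
  have hβ' : ∀ z v, β z v = α₁ z v + Complex.I * α₂ z v := fun z v => by simp [hβ]
  have ho' : ∀ z v, o z v = Complex.I * ρ z v := fun z v => by simp [ho]
  have fβ : ∀ z ∈ V', formInChart (formOfChart x₀ β) x₀ z = β z := fun z hz =>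
    formInChart_formOfChart β (hVt z hz)
  have fo : ∀ z ∈ V', formInChart (formOfChart x₀ o) x₀ z = o z := fun z hz =>
    formInChart_formOfChart o (hVt z hz)
  have hmem : ∀ {z}, z ∈ V' → V' ∈ 𝓝 z := fun hz => hVo.mem_nhds hz
  have dα₁ : ∀ z ∈ V', DifferentiableAt ℝ α₁ z :=
    fun z hz => hα.smooth₁.differentiableAt_of_mem hVo hz
  have dα₂ : ∀ z ∈ V', DifferentiableAt ℝ α₂ z :=
    fun z hz => hα.smooth₂.differentiableAt_of_mem hVo hz
  have Eβ : ∀ z ∈ V', ∀ u v, extD (formOfChart x₀ β) _ (chartDSymm x₀ z u) (chartDSymm x₀ z v)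
      = flatExtD α₁ z u v + Complex.I * flatExtD α₂ z u v := by
    intro z hz u v
    have he := Filter.eventuallyEq_of_mem (hmem hz) fβ
    rw [extD_chartDSymm (hVt z hz)
      (he.differentiableAt_iff.2 (sβ.differentiableAt_of_mem hVo hz)), flatExtD_congr he,
      hβ, flatExtD_add ((differentiableAt_const _).clm_comp (dα₁ z hz))
        ((differentiableAt_const _).clm_comp (dα₂ z hz)), flatExtD_clm_comp _ (dα₁ z hz),
      flatExtD_clm_comp _ (dα₂ z hz)]
    simp
  have Eo : ∀ z ∈ V', ∀ u v, extD (formOfChart x₀ o) _ (chartDSymm x₀ z u) (chartDSymm x₀ z v)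
      = Complex.I * flatExtD ρ z u v := by
    intro z hz u v
    have he := Filter.eventuallyEq_of_mem (hmem hz) fo
    rw [extD_chartDSymm (hVt z hz)
      (he.differentiableAt_iff.2 (so.differentiableAt_of_mem hVo hz)), flatExtD_congr he,
      ho, flatExtD_clm_comp _ (hα.smooth_conn.differentiableAt_of_mem hVo hz)]
    simp
  have lift : ∀ z ∈ V', ∀ v : TangentSpace (𝓡 3) (φ.symm z), ∃ v', chartDSymm x₀ z v' = v :=
    fun z hz v => ⟨_, chartDSymm_chartD (hVt z hz) v⟩
  have Aβ : ∀ z ∈ V', ∀ v, formOfChart x₀ β _ (chartDSymm x₀ z v)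
      = α₁ z v + Complex.I * α₂ z v := by
    intro z hz v
    rw [← formInChart_apply, fβ z hz, hβ']
  have Ao : ∀ z ∈ V', ∀ v, formOfChart x₀ o _ (chartDSymm x₀ z v) = Complex.I * ρ z v := by
    intro z hz v
    rw [← formInChart_apply, fo z hz, ho']
  refine ⟨U, hUo, ⟨φ.map_target (hVt y hyV), by
    rw [mem_preimage, φ.right_inv (hVt y hyV)]; exact hyV⟩, formOfChart x₀ β, formOfChart x₀ o,
    ⟨?_, ?_, ?_⟩, ⟨?_, ?_, ?_⟩, ?_⟩
  · rw [smoothOneFormOn_iff_chart hUo hUs, hUV]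
    exact sβ.congr fβ
  · intro x hx v
    obtain ⟨z, hz, rfl⟩ := hUV' x hx
    obtain ⟨v, hv⟩ := v
    obtain ⟨v', rfl⟩ := lift z hz v
    obtain ⟨a, b, rfl⟩ := hF.span z hz.1 v' hv
    obtain ⟨hm, hJ⟩ := hF.J_X z hz.1
    have hm' : chartDSymm x₀ z (Y z) ∈ S.ξ _ := by rw [← hJ]; exact Subtype.mem _
    have hJY : (S.J _ ⟨_, hm'⟩ : TangentSpace (𝓡 3) _) = -chartDSymm x₀ z (X z) := by
      have h1 : (⟨_, hm'⟩ : S.ξ _) = S.J _ ⟨_, hm⟩ := Subtype.ext hJ.symm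
      rw [h1, S.J_J]; rfl
    have hv2 : (⟨chartDSymm x₀ z (a • X z + b • Y z), hv⟩ : S.ξ _)
        = a • ⟨_, hm⟩ + b • ⟨_, hm'⟩ := by
      apply Subtype.ext
      change chartDSymm x₀ z (a • X z + b • Y z)
        = a • chartDSymm x₀ z (X z) + b • chartDSymm x₀ z (Y z)
      rw [map_add, map_smul, map_smul]
    have hJv : (S.J _ ⟨chartDSymm x₀ z (a • X z + b • Y z), hv⟩ : TangentSpace (𝓡 3) _)
        = chartDSymm x₀ z (a • Y z - b • X z) := by
      have h1 : chartDSymm x₀ z (a • Y z - b • X z)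
          = a • chartDSymm x₀ z (Y z) - b • chartDSymm x₀ z (X z) := by
        rw [map_sub, map_smul, map_smul]
      rw [hv2, map_add, map_smul, map_smul, h1]
      change a • (S.J (φ.symm z) ⟨_, hm⟩ : TangentSpace (𝓡 3) (φ.symm z))
        + b • (S.J (φ.symm z) ⟨_, hm'⟩ : TangentSpace (𝓡 3) (φ.symm z)) = _
      rw [hJ, hJY, smul_neg, sub_eq_add_neg]
    rw [hJv, Aβ z hz, Aβ z hz]
    simp only [map_add, map_sub, map_smul, smul_eq_mul, hα.type₁ z hz, hα.type₂ z hz]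
    push_cast
    linear_combination (-(a : ℂ) * α₂ z (X z) - b * α₁ z (X z)) * Complex.I_mul_I
  · intro x hx u v
    obtain ⟨z, hz, rfl⟩ := hUV' x hx
    obtain ⟨u, rfl⟩ := lift z hz u
    obtain ⟨v, rfl⟩ := lift z hz v
    rw [extD_chartDSymm (hVt z hz) (sΘ.differentiableAt_of_mem hVo hz), hα.levi z hz, wedge_apply,
      conjForm_apply, conjForm_apply, Aβ z hz, Aβ z hz]
    simp only [map_add, map_mul, Complex.conj_I, Complex.conj_ofReal]
    push_cast
    linear_combination (2 * ((α₁ z u : ℂ) * α₂ z v - α₁ z v * α₂ z u)) * Complex.I_mul_I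
  · rw [smoothOneFormOn_iff_chart hUo hUs, hUV]
    exact so.congr fo
  · intro x hx
    obtain ⟨z, hz, rfl⟩ := hUV' x hx
    ext v
    obtain ⟨v, rfl⟩ := lift z hz v
    rw [add_apply, conjForm_apply, Ao z hz]
    simp
    rfl
  · have hab : ∀ x ∈ U, ∃ A : ℂ, ∀ u v : TangentSpace (𝓡 3) x,
        extD (formOfChart x₀ β) x u v = wedge (formOfChart x₀ β x) (formOfChart x₀ o x) u v
          + A * wedge (toComplexForm (θ x)) (conjForm (formOfChart x₀ β x)) u v := by
      intro x hx
      obtain ⟨z, hz, rfl⟩ := hUV' x hx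
      obtain ⟨a, b, hab⟩ := hα.structure_eq z hz
      refine ⟨a + b * Complex.I, fun u v => ?_⟩
      obtain ⟨u, rfl⟩ := lift z hz u
      obtain ⟨v, rfl⟩ := lift z hz v
      rw [Eβ z hz, (hab u v).1, (hab u v).2, wedge_apply, wedge_apply, conjForm_apply,
        conjForm_apply, toComplexForm_apply, toComplexForm_apply, Aβ z hz, Aβ z hz, Ao z hz,
        Ao z hz, ← formInChart_apply, ← formInChart_apply]
      simp only [map_add, map_mul, Complex.conj_I, Complex.conj_ofReal]
      push_cast
      ring_nf
      simp only [Complex.I_sq]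
      ring
    choose! A hA using hab
    exact ⟨A, hA⟩
  · intro u hu v hv
    obtain ⟨u, rfl⟩ := lift y hyV u
    obtain ⟨v, rfl⟩ := lift y hyV v
    obtain ⟨a, b, rfl⟩ := hF.span y hy u hu
    obtain ⟨c, d, rfl⟩ := hF.span y hy v hv
    rw [Eo y hyV, wedge_apply, conjForm_apply, conjForm_apply, Aβ y hyV, Aβ y hyV]
    simp only [flatExtD_add_left, flatExtD_add_right, flatExtD_smul_left, flatExtD_smul_right,
      flatExtD_self, flatExtD_swap ρ y (X y) (Y y), hρ, map_add, map_mul, map_smul, smul_eq_mul,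
      Complex.conj_I, Complex.conj_ofReal, hα.type₁ y hyV, hα.type₂ y hyV]
    push_cast
    ring

/-- Near each point, the Tanaka-Webster curvature of a conformal multiple `e^{2f} θ` is
`e^{-2f} (K - 2 (XXf + YYf) - 2 ((Xf)² + (Yf)²) + ...)`, where the terms that are left out
are linear in the first derivatives of `f`. -/
lemma exists_tanakaWebster_conformal (hθ : IsPosPseudohermitian S θ) (x₀ : M) :
    ∃ (V : Set E3) (X Y : E3 → E3) (K a b : ℝ), IsOpen V ∧ V ⊆ (extChartAt (𝓡 3) x₀).target ∧
      extChartAt (𝓡 3) x₀ x₀ ∈ V ∧ ContDiffOn ℝ ∞ X V ∧ ContDiffOn ℝ ∞ Y V ∧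
      ∀ θ' : RealOneForm M, IsPosPseudohermitian S θ' → ∀ g : M → ℝ,
        (∀ x, θ' x = Real.exp (2 * g x) • θ x) →
        ∀ f : E3 → ℝ, f = (fun y => g ((extChartAt (𝓡 3) x₀).symm y)) → ContDiffOn ℝ ∞ f V →
        tanakaWebster S θ' x₀ = Real.exp (-2 * f (extChartAt (𝓡 3) x₀ x₀)) *
          (K - 2 * (dirDeriv X (dirDeriv X f) (extChartAt (𝓡 3) x₀ x₀)
              + dirDeriv Y (dirDeriv Y f) (extChartAt (𝓡 3) x₀ x₀))
            - 2 * (dirDeriv X f (extChartAt (𝓡 3) x₀ x₀) ^ 2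
              + dirDeriv Y f (extChartAt (𝓡 3) x₀ x₀) ^ 2)
            - 2 * (dirDeriv X f (extChartAt (𝓡 3) x₀ x₀) * a
              - dirDeriv Y f (extChartAt (𝓡 3) x₀ x₀) * b)) := by
  obtain ⟨V, X, Y, e₁, e₂, T, hy, hF, hR⟩ := exists_adapted_reebFrame hθ x₀
  obtain ⟨ρ, hρ⟩ := hR.exists_connection
  set y₀ := extChartAt (𝓡 3) x₀ x₀ with hy₀
  refine ⟨V, X, Y, -(1 / 2) * flatExtD ρ y₀ (X y₀) (Y y₀), ρ y₀ (Y y₀), ρ y₀ (X y₀), hF.isOpen,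
    hF.subset, hy, hF.smooth_X, hF.smooth_Y, ?_⟩
  intro θ' hθ' g hg f hf sf
  have hx₀ : (extChartAt (𝓡 3) x₀).symm y₀ = x₀ := extChartAt_to_inv x₀
  have hform : formInChart θ' x₀ = fun z => Real.exp (2 * f z) • formInChart θ x₀ z := by
    funext z
    ext v
    rw [formInChart_apply, hg, hf]; rfl
  have key : ∀ w, IsTanakaWebsterAt S θ' x₀ w ↔
      IsFlatTanakaWebsterAt X Y (formInChart θ' x₀) y₀ w := by
    intro w
    conv_lhs => rw [← hx₀]
    exact ⟨fun h => h.flat hθ' hF hy, fun h => h.lift hθ' hF hy⟩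
  simp only [hform, hR.isFlatTanakaWebsterAt_conformal_iff sf hρ hy] at key
  -- exactly one number is a Tanaka-Webster curvature at `x₀`, so `tanakaWebster` is that number
  exact (key _).1 (Classical.epsilon_spec ⟨_, (key _).2 rfl⟩)

end Bridge

/-! ### Functions of time and space -/

section TimeDependence

variable {E : Type*} [NormedAddCommGroup E] [NormedSpace ℝ E]

/-- A vector field on `E` as a vector field on `ℝ × E`. -/
def spatial (X : E → E) (p : ℝ × E) : ℝ × E := (0, X p.2)

/-- The time direction on `ℝ × E`. -/
def timeDir (_ : ℝ × E) : ℝ × E := (1, 0)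

variable {X : E → E} {V : Set E} {O : Set ℝ} {G : ℝ × E → ℝ}

lemma contDiffOn_spatial (hX : ContDiffOn ℝ ∞ X V) : ContDiffOn ℝ ∞ (spatial X) (O ×ˢ V) :=
  contDiffOn_const.prodMk (hX.comp contDiffOn_snd fun _ hp => hp.2)

lemma dirDeriv_slice {p : ℝ × E} (hG : DifferentiableAt ℝ G p) :
    dirDeriv X (fun y => G (p.1, y)) p.2 = dirDeriv (spatial X) G p := by
  have h := hG.hasFDerivAt.comp p.2 (hasFDerivAt_prodMk_right (𝕜 := ℝ) p.1 p.2)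
  rw [dirDeriv]
  erw [h.fderiv]
  simp [dirDeriv, spatial]

lemma hasDerivAt_slice {p : ℝ × E} (hG : DifferentiableAt ℝ G p) :
    HasDerivAt (fun s => G (s, p.2)) (dirDeriv timeDir G p) p.1 := by
  have h := (hG.hasFDerivAt.comp p.1 (hasFDerivAt_prodMk_left p.1 p.2)).hasDerivAt
  simpa [dirDeriv, timeDir, Function.comp_def] using h

/-- Time derivatives commute with derivatives along time-independent vector fields. -/
lemma dirDeriv_timeDir_comm (hO : IsOpen O) (hV : IsOpen V) (hX : ContDiffOn ℝ ∞ X V)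
    (hG : ContDiffOn ℝ ∞ G (O ×ˢ V)) {p : ℝ × E} (hp : p ∈ O ×ˢ V) :
    dirDeriv timeDir (dirDeriv (spatial X) G) p = dirDeriv (spatial X) (dirDeriv timeDir G) p := by
  have hOV : IsOpen (O ×ˢ V) := hO.prod hV
  have hs : IsSymmSndFDerivAt ℝ G p :=
    (hG.contDiffAt (hOV.mem_nhds hp)).isSymmSndFDerivAt (by simpa using two_le_infty)
  have h2 := ((hG.fderiv_smooth hOV).differentiableAt_of_mem hOV hp).hasFDerivAt
  have hX' : HasFDerivAt (spatial X)
      ((0 : ℝ × E →L[ℝ] ℝ).prod ((fderiv ℝ X p.2).comp (ContinuousLinearMap.snd ℝ ℝ E))) p :=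
    (hasFDerivAt_const (0 : ℝ) p).prodMk
      ((hX.differentiableAt_of_mem hV hp.2).hasFDerivAt.comp p hasFDerivAt_snd)
  have e1 := (h2.clm_apply hX').fderiv
  have e2 := (h2.clm_apply (hasFDerivAt_const ((1 : ℝ), (0 : E)) p)).fderiv
  have e3 : dirDeriv timeDir (dirDeriv (spatial X) G) p
      = fderiv ℝ (fun q => fderiv ℝ G q (spatial X q)) p (1, 0) := rfl
  have e4 : dirDeriv (spatial X) (dirDeriv timeDir G) p
      = fderiv ℝ (fun q => fderiv ℝ G q (1, 0)) p (spatial X p) := rfl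
  rw [e3, e4, e1, e2]
  simp [hs.eq (1, 0) (spatial X p)]
  exact map_zero (fderiv ℝ G p)

/-- At a local maximum, first derivatives vanish and second derivatives are not positive. -/
lemma dirDeriv_of_isLocalMax {h : E → ℝ} {y : E} (hV : IsOpen V) (hy : y ∈ V)
    (hX : ContDiffOn ℝ ∞ X V) (hh : ContDiffOn ℝ ∞ h V) (hm : IsLocalMax h y) :
    dirDeriv X h y = 0 ∧ dirDeriv X (dirDeriv X h) y ≤ 0 := by
  have h0 : fderiv ℝ h y = 0 := hm.fderiv_eq_zero
  refine ⟨by simp [dirDeriv, h0], ?_⟩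
  have d2 := (hh.fderiv_smooth hV).differentiableAt_of_mem hV hy
  have e : dirDeriv X (dirDeriv X h) y = fderiv ℝ (fderiv ℝ h) y (X y) (X y) := by
    have := (d2.hasFDerivAt.clm_apply (hX.differentiableAt_of_mem hV hy).hasFDerivAt).fderiv
    have e1 : dirDeriv X (dirDeriv X h) y = fderiv ℝ (fun z => fderiv ℝ h z (X z)) y (X y) := rfl
    rw [e1, this]
    simp [h0]
  rw [e]
  -- restrict to the line through `y` in the direction `X y` and use the second derivative test
  set g : ℝ → ℝ := fun r => h (y + r • X y) with hg
  have hl : ∀ r : ℝ, HasDerivAt (fun r : ℝ => y + r • X y) (X y) r := fun r => by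
    simpa using ((hasDerivAt_id r).smul_const (X y)).const_add y
  have hc : ContinuousAt (fun r : ℝ => y + r • X y) 0 := (hl 0).continuousAt
  have hc0 : Filter.Tendsto (fun r : ℝ => y + r • X y) (𝓝 0) (𝓝 y) := by
    simpa [ContinuousAt] using hc
  have hg1 : ∀ᶠ r in 𝓝 (0 : ℝ), HasDerivAt g (fderiv ℝ h (y + r • X y) (X y)) r := by
    filter_upwards [hc0.eventually (hV.mem_nhds hy)] with r hr
    have hr' : y + r • X y ∈ V := hr
    exact HasFDerivAt.comp_hasDerivAt (l := h) (f := fun r : ℝ => y + r • X y) r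
      (hh.differentiableAt_of_mem hV hr').hasFDerivAt (hl r)
  have hgd : deriv g =ᶠ[𝓝 0] fun r => fderiv ℝ h (y + r • X y) (X y) := by
    filter_upwards [hg1] with r hr using hr.deriv
  have hg2 : deriv (deriv g) 0 = fderiv ℝ (fderiv ℝ h) y (X y) (X y) := by
    rw [hgd.deriv_eq]
    have h1 : HasDerivAt (fderiv ℝ h ∘ fun r : ℝ => y + r • X y)
        (fderiv ℝ (fderiv ℝ h) y (X y)) 0 :=
      d2.hasFDerivAt.comp_hasDerivAt_of_eq (0 : ℝ) (hl 0) (by simp)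
    have h2 := (h1.clm_apply (hasDerivAt_const (0 : ℝ) (X y))).deriv
    simp only [map_zero, add_zero] at h2
    exact h2
  have hgm : IsLocalMax g 0 := by
    have := hc0.eventually hm
    filter_upwards [this] with r hr
    simpa [hg] using hr
  rw [← hg2]
  by_contra! hpos
  -- otherwise `g` would have a local minimum too, hence be constant near `0`
  have hmin := isLocalMin_of_deriv_deriv_pos hpos (by rw [hgm.deriv_eq_zero])
    (hg1.self_of_nhds.continuousAt)
  have hconst : g =ᶠ[𝓝 0] fun _ => g 0 := by
    filter_upwards [hgm, hmin] with r h1 h2 using le_antisymm h1 h2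
  have h3 : deriv g =ᶠ[𝓝 0] fun _ => 0 := by
    filter_upwards [hconst.eventuallyEq_nhds] with r hr
    rw [hr.deriv_eq]; simp
  rw [h3.deriv_eq] at hpos
  simp at hpos

end TimeDependence

/-! ### The curvature along the Yamabe flow -/

section Flow

variable {M : Type*} [TopologicalSpace M] [ChartedSpace E3 M] [IsManifold (𝓡 3) ∞ M]
variable {S : CRStructure M} {I : Set ℝ} {θ : ℝ → RealOneForm M} {θhat : RealOneForm M}
  {lam : ℝ × M → ℝ}

/-- The conformal factor evolves by `∂ₜ λ = -W`. -/
lemma hasDerivWithinAt_conformalFactor (hθ : IsYamabeFlow S I θ)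
    (hhat : IsPosPseudohermitian S θhat)
    (hlam : ∀ t ∈ I, ∀ x : M, θ t x = Real.exp (2 * lam (t, x)) • θhat x) {t : ℝ} (ht : t ∈ I)
    (x : M) : HasDerivWithinAt (fun s => lam (s, x)) (-tanakaWebster S (θ t) x) I t := by
  obtain ⟨v, hv⟩ := hhat.exists_ne_zero x
  have h1 := hθ.evolution t ht x v
  have h2 : ∀ s ∈ I, θ s x v / θhat x v = Real.exp (2 * lam (s, x)) := by
    intro s hs
    rw [hlam s hs x, smul_apply, smul_eq_mul, mul_div_cancel_right₀ _ hv]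
  -- `λ` is recovered from the values of the flow on `v`
  have h3 : ∀ s ∈ I, lam (s, x) = 1 / 2 * Real.log (θ s x v / θhat x v) := by
    intro s hs
    rw [h2 s hs, Real.log_exp]; ring
  have h4 := ((h1.div_const (θhat x v)).log (by rw [h2 t ht]; exact Real.exp_ne_zero _)).const_mul
    (1 / 2 : ℝ)
  refine (h4.congr h3 (h3 t ht)).congr_deriv ?_
  have h5 : θ t x v ≠ 0 := by
    rw [hlam t ht x, smul_apply, smul_eq_mul]
    exact mul_ne_zero (Real.exp_ne_zero _) hv
  field_simp

/-- The conformal factor in the chart around `x₀`. -/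
noncomputable def chartFactor (lam : ℝ × M → ℝ) (x₀ : M) (p : ℝ × E3) : ℝ :=
  lam (p.1, (extChartAt (𝓡 3) x₀).symm p.2)

lemma contDiffOn_chartFactor
    (hs : ContMDiffOn (𝓘(ℝ, ℝ).prod (𝓡 3)) 𝓘(ℝ, ℝ) ∞ lam (I ×ˢ univ)) (x₀ : M) :
    ContDiffOn ℝ ∞ (chartFactor lam x₀) (I ×ˢ (extChartAt (𝓡 3) x₀).target) := by
  have h1 : ContMDiffOn (𝓘(ℝ, ℝ).prod 𝓘(ℝ, E3)) (𝓘(ℝ, ℝ).prod (𝓡 3)) ∞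
      (fun p : ℝ × E3 => (p.1, (extChartAt (𝓡 3) x₀).symm p.2))
      (I ×ˢ (extChartAt (𝓡 3) x₀).target) :=
    contMDiffOn_fst.prodMk
      ((contMDiffOn_extChartAt_symm x₀).comp contMDiffOn_snd fun p hp => hp.2)
  have h2 := hs.comp h1 fun p hp => ⟨hp.1, mem_univ _⟩
  rw [← modelWithCornersSelf_prod, chartedSpaceSelf_prod] at h2
  exact h2.contDiffOn

/-- The curvature is jointly continuous in space and time, since `W = -∂ₜ λ`. -/
lemma continuousOn_tanakaWebster (hθ : IsYamabeFlow S I θ) (hI : UniqueDiffOn ℝ I)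
    (hhat : IsPosPseudohermitian S θhat)
    (hs : ContMDiffOn (𝓘(ℝ, ℝ).prod (𝓡 3)) 𝓘(ℝ, ℝ) ∞ lam (I ×ˢ univ))
    (hlam : ∀ t ∈ I, ∀ x : M, θ t x = Real.exp (2 * lam (t, x)) • θhat x) :
    ContinuousOn (fun p : ℝ × M => tanakaWebster S (θ p.1) p.2) (I ×ˢ univ) := by
  rintro ⟨t, x₀⟩ ⟨ht, -⟩
  set φ := extChartAt (𝓡 3) x₀ with hφ
  have hΛ := contDiffOn_chartFactor hs x₀
  have hu : UniqueDiffOn ℝ (I ×ˢ φ.target) := hI.prod (isOpen_extChartAt_target x₀).uniqueDiffOn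
  have hc := hΛ.continuousOn_fderivWithin hu (by simp)
  have key : ∀ p ∈ I ×ˢ φ.source, tanakaWebster S (θ p.1) p.2
      = -fderivWithin ℝ (chartFactor lam x₀) (I ×ˢ φ.target) (p.1, φ p.2) (1, 0) := by
    rintro ⟨s, x⟩ ⟨hs, hx⟩
    have hx' : φ x ∈ φ.target := φ.map_source hx
    have h1 := (hΛ.differentiableOn (by simp) (s, φ x) ⟨hs, hx'⟩).hasFDerivWithinAt
    have h2 : HasDerivWithinAt (fun r => chartFactor lam x₀ (r, φ x))
        (fderivWithin ℝ (chartFactor lam x₀) (I ×ˢ φ.target) (s, φ x) (1, 0)) I s := by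
      exact h1.comp_hasDerivWithinAt s
        ((hasDerivAt_id s).prodMk (hasDerivAt_const s (φ x))).hasDerivWithinAt
        (fun r hr => (⟨hr, hx'⟩ : (r, φ x) ∈ I ×ˢ φ.target))
    have h3 := hasDerivWithinAt_conformalFactor hθ hhat hlam hs x
    have h4 : (fun r => chartFactor lam x₀ (r, φ x)) = fun r => lam (r, x) := by
      funext r
      simp only [chartFactor]
      rw [← hφ, φ.left_inv hx]
    rw [h4] at h2
    have := (hI s hs).eq_deriv _ h2 h3
    simp only at this ⊢
    linarith
  have hnhds : I ×ˢ φ.source ∈ 𝓝[I ×ˢ univ] (t, x₀) := by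
    have : (univ : Set ℝ) ×ˢ φ.source ∈ 𝓝 (t, x₀) :=
      (isOpen_univ.prod (isOpen_extChartAt_source x₀)).mem_nhds
        ⟨mem_univ _, mem_extChartAt_source x₀⟩
    filter_upwards [mem_nhdsWithin_of_mem_nhds this, self_mem_nhdsWithin] with p h1 h2
    exact ⟨h2.1, h1.2⟩
  have hcont : ContinuousOn (fun p : ℝ × M =>
      -fderivWithin ℝ (chartFactor lam x₀) (I ×ˢ φ.target) (p.1, φ p.2) (1, 0))
      (I ×ˢ φ.source) := by
    have h1 : ContinuousOn (fun p : ℝ × M => (p.1, φ p.2)) (I ×ˢ φ.source) :=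
      continuousOn_fst.prodMk ((continuousOn_extChartAt x₀).comp continuousOn_snd fun p hp => hp.2)
    have h2 := hc.comp h1 fun p hp => ⟨hp.1, φ.map_source hp.2⟩
    exact (h2.clm_apply continuousOn_const).neg
  have h5 : (t, x₀) ∈ I ×ˢ φ.source := ⟨ht, mem_extChartAt_source x₀⟩
  exact ((hcont.congr key) _ h5).mono_of_mem_nhdsWithin hnhds

/-- At a spatial minimum of `W`, the time derivative of `W` is at least `2 W² ≥ 0`. -/
lemma exists_hasDerivAt_of_isMin (hθ : IsYamabeFlow S I θ)
    (hhat : IsPosPseudohermitian S θhat)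
    (hs : ContMDiffOn (𝓘(ℝ, ℝ).prod (𝓡 3)) 𝓘(ℝ, ℝ) ∞ lam (I ×ˢ univ))
    (hlam : ∀ t ∈ I, ∀ x : M, θ t x = Real.exp (2 * lam (t, x)) • θhat x) {t : ℝ}
    (ht : t ∈ interior I) {x₀ : M}
    (hmin : ∀ x, tanakaWebster S (θ t) x₀ ≤ tanakaWebster S (θ t) x) :
    ∃ d, 0 ≤ d ∧ HasDerivAt (fun s => tanakaWebster S (θ s) x₀) d t := by
  obtain ⟨V, X, Y, K, a, b, hVo, hVt, hy, sX, sY, hW⟩ := exists_tanakaWebster_conformal hhat x₀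
  set y₀ := extChartAt (𝓡 3) x₀ x₀ with hy₀
  set O := interior I with hOdef
  have hO : IsOpen O := isOpen_interior
  have hOV : IsOpen (O ×ˢ V) := hO.prod hVo
  set G := chartFactor lam x₀ with hG
  have sG : ContDiffOn ℝ ∞ G (O ×ˢ V) :=
    (contDiffOn_chartFactor hs x₀).mono (prod_mono interior_subset hVt)
  have sX' := contDiffOn_spatial (O := O) sX
  have sY' := contDiffOn_spatial (O := O) sY
  have sT : ContDiffOn ℝ ∞ (timeDir : ℝ × E3 → ℝ × E3) (O ×ˢ V) := contDiffOn_const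
  have sGX := sG.dirDeriv_smooth sX' hOV
  have sGY := sG.dirDeriv_smooth sY' hOV
  have sGXX := sGX.dirDeriv_smooth sX' hOV
  have sGYY := sGY.dirDeriv_smooth sY' hOV
  set H := dirDeriv timeDir G with hH
  have sH : ContDiffOn ℝ ∞ H (O ×ˢ V) := sG.dirDeriv_smooth sT hOV
  have slice : ∀ {Q : ℝ × E3 → ℝ}, ContDiffOn ℝ ∞ Q (O ×ˢ V) → ∀ s ∈ O,
      ContDiffOn ℝ ∞ (fun y => Q (s, y)) V := fun hQ s hs =>
    hQ.comp (contDiffOn_const.prodMk contDiffOn_id) fun y hy => ⟨hs, hy⟩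
  have dd : ∀ {Q : ℝ × E3 → ℝ} {Z : E3 → E3}, ContDiffOn ℝ ∞ Q (O ×ˢ V) → ∀ s ∈ O, ∀ y ∈ V,
      dirDeriv Z (fun y => Q (s, y)) y = dirDeriv (spatial Z) Q (s, y) := fun hQ s hs y hy =>
    dirDeriv_slice (p := (s, y)) (hQ.differentiableAt_of_mem hOV ⟨hs, hy⟩)
  have ddd : ∀ {Q : ℝ × E3 → ℝ} {Z : E3 → E3}, ContDiffOn ℝ ∞ Q (O ×ˢ V) →
      ContDiffOn ℝ ∞ Z V → ∀ s ∈ O, ∀ y ∈ V,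
      dirDeriv Z (dirDeriv Z (fun y => Q (s, y))) y
        = dirDeriv (spatial Z) (dirDeriv (spatial Z) Q) (s, y) := by
    intro Q Z hQ hZ s hs y hy
    have he : dirDeriv Z (fun y => Q (s, y)) =ᶠ[𝓝 y] fun y => dirDeriv (spatial Z) Q (s, y) := by
      filter_upwards [hVo.mem_nhds hy] with z hz using dd hQ s hs z hz
    rw [dirDeriv, he.fderiv_eq]
    exact dd (hQ.dirDeriv_smooth (contDiffOn_spatial hZ) hOV) s hs y hy
  -- the curvature at `x₀` in terms of the conformal factor
  have hWs : ∀ s ∈ O, tanakaWebster S (θ s) x₀ = Real.exp (-2 * G (s, y₀)) *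
      (K - 2 * (dirDeriv (spatial X) (dirDeriv (spatial X) G) (s, y₀)
          + dirDeriv (spatial Y) (dirDeriv (spatial Y) G) (s, y₀))
        - 2 * (dirDeriv (spatial X) G (s, y₀) ^ 2 + dirDeriv (spatial Y) G (s, y₀) ^ 2)
        - 2 * (dirDeriv (spatial X) G (s, y₀) * a - dirDeriv (spatial Y) G (s, y₀) * b)) := by
    intro s hsO
    have hsI := interior_subset hsO
    rw [hW (θ s) (hθ.pseudohermitian s hsI) (fun x => lam (s, x)) (hlam s hsI)
      (fun y => G (s, y)) rfl (slice sG s hsO), ddd sG sX s hsO y₀ hy, ddd sG sY s hsO y₀ hy,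
      dd sG s hsO y₀ hy, dd sG s hsO y₀ hy]
  -- the time derivative of the conformal factor is `-W`
  have hHW : ∀ s ∈ O, ∀ y ∈ V, H (s, y)
      = -tanakaWebster S (θ s) ((extChartAt (𝓡 3) x₀).symm y) := by
    intro s hsO y hyV
    have h1 := hasDerivAt_slice (sG.differentiableAt_of_mem hOV (⟨hsO, hyV⟩ : (s, y) ∈ O ×ˢ V))
    have h2 := (hasDerivWithinAt_conformalFactor hθ hhat hlam (interior_subset hsO)
      ((extChartAt (𝓡 3) x₀).symm y)).hasDerivAt (mem_interior_iff_mem_nhds.1 hsO)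
    exact h1.unique h2
  have hx₀ : (extChartAt (𝓡 3) x₀).symm y₀ = x₀ := extChartAt_to_inv x₀
  have hmax : IsLocalMax (fun y => H (t, y)) y₀ := by
    filter_upwards [hVo.mem_nhds hy] with y hyV
    rw [hHW t ht y hyV, hHW t ht y₀ hy, hx₀]
    exact neg_le_neg (hmin _)
  obtain ⟨mX, mXX⟩ := dirDeriv_of_isLocalMax hVo hy sX (slice sH t ht) hmax
  obtain ⟨mY, mYY⟩ := dirDeriv_of_isLocalMax hVo hy sY (slice sH t ht) hmax
  rw [dd sH t ht y₀ hy] at mX mY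
  rw [ddd sH sX t ht y₀ hy] at mXX
  rw [ddd sH sY t ht y₀ hy] at mYY
  have hp : (t, y₀) ∈ O ×ˢ V := ⟨ht, hy⟩
  have comm : ∀ {Z : E3 → E3}, ContDiffOn ℝ ∞ Z V → ∀ p ∈ O ×ˢ V,
      dirDeriv timeDir (dirDeriv (spatial Z) G) p = dirDeriv (spatial Z) H p :=
    fun hZ p hp => dirDeriv_timeDir_comm hO hVo hZ sG hp
  have comm2 : ∀ {Z : E3 → E3}, ContDiffOn ℝ ∞ Z V →
      dirDeriv timeDir (dirDeriv (spatial Z) (dirDeriv (spatial Z) G)) (t, y₀)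
        = dirDeriv (spatial Z) (dirDeriv (spatial Z) H) (t, y₀) := by
    intro Z hZ
    rw [dirDeriv_timeDir_comm hO hVo hZ (sG.dirDeriv_smooth (contDiffOn_spatial hZ) hOV) hp]
    have he : dirDeriv timeDir (dirDeriv (spatial Z) G) =ᶠ[𝓝 (t, y₀)] dirDeriv (spatial Z) H := by
      filter_upwards [hOV.mem_nhds hp] with p hp using comm hZ p hp
    rw [dirDeriv, he.fderiv_eq]; rfl
  have DG := hasDerivAt_slice (sG.differentiableAt_of_mem hOV hp)
  have DX := hasDerivAt_slice (sGX.differentiableAt_of_mem hOV hp)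
  have DY := hasDerivAt_slice (sGY.differentiableAt_of_mem hOV hp)
  have DXX := hasDerivAt_slice (sGXX.differentiableAt_of_mem hOV hp)
  have DYY := hasDerivAt_slice (sGYY.differentiableAt_of_mem hOV hp)
  rw [comm sX _ hp, mX] at DX
  rw [comm sY _ hp, mY] at DY
  rw [comm2 sX] at DXX
  rw [comm2 sY] at DYY
  -- Differentiate the formula for `W` in time. Terms that hold a first derivative of `H` vanish.
  have D := (DG.const_mul (-2)).exp.mul (((((DXX.add DYY).const_mul 2).const_sub K).sub
    (((DX.pow 2).add (DY.pow 2)).const_mul 2)).sub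
    (((DX.mul_const a).sub (DY.mul_const b)).const_mul 2))
  have hWt := hWs t ht
  have hHt := hHW t ht y₀ hy
  rw [hx₀] at hHt
  refine ⟨_, ?_, D.congr_of_eventuallyEq ?_⟩
  · have hE := Real.exp_pos (-2 * G (t, y₀))
    have h1 : 0 ≤ Real.exp (-2 * G (t, y₀)) *
        -(2 * (dirDeriv (spatial X) (dirDeriv (spatial X) H) (t, y₀) +
          dirDeriv (spatial Y) (dirDeriv (spatial Y) H) (t, y₀))) :=
      mul_nonneg hE.le (by linarith)
    have h2 := sq_nonneg (tanakaWebster S (θ t) x₀)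
    have h3 : dirDeriv timeDir G (t, y₀) = -tanakaWebster S (θ t) x₀ := hHt
    simp only [mul_zero, sub_zero, add_zero, zero_mul, Pi.sub_apply, Pi.add_apply, Pi.pow_apply, h3]
    linear_combination h1 + 2 * h2 + 2 * tanakaWebster S (θ t) x₀ * hWt
  · filter_upwards [hO.mem_nhds ht] with s hs
    rw [hWs s hs]
    simp

end Flow

/-- Along a smooth solution of the Yamabe flow on a closed pseudohermitian 3-manifold, defined on a
time interval `I` that starts at `0`, a positive lower bound `c` of the initial Tanaka-Webster
curvature remains a lower bound at all times. -/
theorem corollary2p2 {M : Type*} [TopologicalSpace M] [T2Space M] [CompactSpace M]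
    [ChartedSpace E3 M] [IsManifold (𝓡 3) ∞ M] (S : CRStructure M)
    (I : Set ℝ) (hI : I.OrdConnected) (h0 : (0 : ℝ) ∈ I) (hI0 : I ⊆ Set.Ici 0)
    (θ : ℝ → RealOneForm M) (hθ : IsYamabeFlow S I θ)
    (c : ℝ) (hc : 0 < c) (hW : ∀ x : M, c ≤ tanakaWebster S (θ 0) x) :
    ∀ t ∈ I, ∀ x : M, c ≤ tanakaWebster S (θ t) x := by
  obtain ⟨θhat, hhat, lam, hs, hlam⟩ := hθ.smooth
  intro t₁ ht₁ x₁
  rcases (show (0 : ℝ) ≤ t₁ from hI0 ht₁).eq_or_lt with rfl | hpos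
  · exact hW x₁
  have hsub : Icc 0 t₁ ⊆ I := hI.out h0 ht₁
  have hint : Ioo 0 t₁ ⊆ interior I :=
    interior_maximal (Ioo_subset_Icc_self.trans hsub) isOpen_Ioo
  have hu : UniqueDiffOn ℝ I := uniqueDiffOn_convex hI.convex
    ⟨t₁ / 2, hint ⟨by linarith, by linarith⟩⟩
  have hcont := continuousOn_tanakaWebster hθ hu hhat hs hlam
  -- For times in the interior of `I`, minimize `W + ε t` over `[0, t₂] × M`.
  have inner : ∀ t₂ ∈ Ioo 0 t₁, ∀ x₂, c ≤ tanakaWebster S (θ t₂) x₂ := by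
    intro t₂ ht₂ x₂
    by_contra! hlt
    obtain ⟨ε, hε, hεlt⟩ : ∃ ε > 0, tanakaWebster S (θ t₂) x₂ + ε * t₂ < c := by
      refine ⟨(c - tanakaWebster S (θ t₂) x₂) / (2 * t₂),
        div_pos (by linarith) (by linarith [ht₂.1]), ?_⟩
      have := ht₂.1
      field_simp
      linarith
    have hsub₂ : Icc 0 t₂ ×ˢ (univ : Set M) ⊆ I ×ˢ univ :=
      prod_mono ((Icc_subset_Icc_right ht₂.2.le).trans hsub) subset_rfl
    obtain ⟨⟨t, x⟩, ⟨ht, -⟩, hmin⟩ := (isCompact_Icc.prod isCompact_univ).exists_isMinOn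
      (s := Icc 0 t₂ ×ˢ (univ : Set M)) ⟨(t₂, x₂), ⟨ht₂.1.le, le_rfl⟩, mem_univ _⟩
      ((hcont.mono hsub₂).add (continuousOn_const.mul continuousOn_fst) :
        ContinuousOn (fun p : ℝ × M => tanakaWebster S (θ p.1) p.2 + ε * p.1) _)
    replace hmin : ∀ s ∈ Icc 0 t₂, ∀ x',
        tanakaWebster S (θ t) x + ε * t ≤ tanakaWebster S (θ s) x' + ε * s :=
      fun s hs x' => isMinOn_iff.1 hmin (s, x') ⟨hs, mem_univ _⟩
    have hle := hmin t₂ ⟨ht₂.1.le, le_rfl⟩ x₂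
    -- the minimum is below `c`, so it is not attained at the initial time
    have htpos : 0 < t := by
      rcases ht.1.eq_or_lt with rfl | h
      · linarith [hW x]
      · exact h
    have htI : t ∈ interior I := hint ⟨htpos, ht.2.trans_lt ht₂.2⟩
    obtain ⟨d, hd, hD⟩ := exists_hasDerivAt_of_isMin hθ hhat hs hlam htI (x₀ := x)
      fun x' => by linarith [hmin t ht x']
    have hD' : HasDerivAt (fun s => tanakaWebster S (θ s) x + ε * s) (d + ε) t := by
      simpa [Pi.add_def] using hD.add ((hasDerivAt_id t).const_mul ε)
    -- `W + ε t` increases strictly at `t`, against its minimality among earlier times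
    have hslope := (hasDerivAt_iff_tendsto_slope.1 hD').eventually (lt_mem_nhds (by linarith :
      0 < d + ε))
    have hev : ∀ᶠ s in 𝓝[<] t, False := by
      filter_upwards [hslope.filter_mono (nhdsWithin_mono t fun s (hs : s < t) => hs.ne),
        Ioo_mem_nhdsLT htpos] with s h1 h2
      have h3 := hmin s ⟨h2.1.le, h2.2.le.trans ht.2⟩ x
      rw [slope_def_field] at h1
      exact h1.not_ge (div_nonpos_of_nonneg_of_nonpos (by linarith) (by linarith [h2.2]))
    exact hev.exists.elim fun _ h => h
  -- `t₁` may be the right end point of `I`, where the bound holds by continuity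
  have hct : ContinuousWithinAt (fun s => tanakaWebster S (θ s) x₁) (Ioo 0 t₁) t₁ := by
    have h1 : ContinuousWithinAt (fun s : ℝ => (s, x₁)) (Ioo 0 t₁) t₁ :=
      (continuous_id.prodMk continuous_const).continuousWithinAt
    exact ContinuousWithinAt.comp (f := fun s : ℝ => (s, x₁))
      (g := fun p : ℝ × M => tanakaWebster S (θ p.1) p.2) (t := I ×ˢ univ) (x := t₁)
      (hcont (t₁, x₁) ⟨ht₁, mem_univ _⟩) h1
      fun s hs => ⟨hsub (Ioo_subset_Icc_self hs), mem_univ _⟩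
  have : (𝓝[Ioo 0 t₁] t₁).NeBot := by
    rw [← mem_closure_iff_nhdsWithin_neBot, closure_Ioo hpos.ne]
    exact ⟨hpos.le, le_rfl⟩
  exact ge_of_tendsto hct (Filter.eventually_of_mem self_mem_nhdsWithin fun s hs => inner s hs x₁)
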